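/- Let $q\ge 1$ be an integer. Functions $\mathbb R^q\to\mathbb C$ that are $2\pi$-periodic in each variable are identified with functions on $[-\pi,\pi]^q$ and on the torus $(\mathbb R/2\pi\mathbb Z)^q$ with Lebesgue measure of total mass $(2\pi)^q$; $\|\cdot\|_p$ is the norm of $L^p=L^p([-\pi,\pi]^q)$. The conjugate exponent of $p\in[1,\infty]$ is $p'$, with $1'=\infty$, $\infty'=1$, and $q/\infty=0$. For $\mathbf k\in\mathbb Z^q$, $\|\mathbf k\|$ is the Euclidean norm, and $\hat f(\mathbf k)=(2\pi)^{-q}\int_{[-\pi,\pi]^q} f(\mathbf x)e^{-i\mathbf k\cdot\mathbf x}\,d\mathbf x$ for $f\in L^1$. For $s\in\mathbb R$ and $1\le p\le\infty$, $W_s^p$ is the class of all $f\in L^p$ for which there is $f^{(s)}\in L^p$ with $\widehat{f^{(s)}}(\mathbf k)=(\|\mathbf k\|^2+1)^{s/2}\hat f(\mathbf k)$ for all $\mathbf k\in\mathbb Z^q$, and $\|f\|_{W_s^p}=\|f^{(s)}\|_p$. For $r\geq 0$, $\mathbb H_r^q$ is the span of the functions $e^{i\mathbf k\cdot\mathbf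 x}$ with $\mathbf k\in\mathbb Z^q$, $\|\mathbf k\|\le r$, and $E_{r,\infty}(f)=\inf_{T\in\mathbb H_r^q}\|f-T\|_\infty$. **Proposition 2.1.** Let $1\le p\le\infty$ and $s>q/p$. (a) There is a function $K_s\in L^{p'}$ with $\widehat{K_s}(\mathbf k)=(\|\mathbf k\|^2+1)^{-s/2}$ for all $\mathbf k\in\mathbb Z^q$, such that for every $f\in W_s^p$ and almost every $\mathbf x\in[-\pi,\pi]^q$, $$f(\mathbf x)=\frac1{(2\pi)^q}\int_{[-\pi,\pi]^q}K_s(\mathbf x-\mathbf y)f^{(s)}(\mathbf y)\,d\mathbf y=\frac1{(2\pi)^q}\int_{[-\pi,\pi]^q}K_s(\mathbf y-\mathbf x)f^{(s)}(\mathbf y)\,d\mathbf y,$$ where both integrals converge absolutely. (b) Every $f\in W_s^p$ is almost everywhere equal to a continuous $2\pi$-periodic function, which is again denoted by $f$ in (c) and (d). (c) There is a constant $c>0$ depending only on $p,q,s$ such that for all $f\in W_s^p$ and all integers $n\ge 0$, $$E_{2^n,\infty}(f)\le c\,2^{-n(s-q/p)}\|f\|_{W_s^p}.$$ (d) For every $s'$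 with $0<s'<s-q/p$ there are constants $c_1,c_2>0$ depending only on $p,q,s,s'$ such that every $f\in W_s^p$ belongs to $W_{s'}^\infty$ and $$\|f\|_\infty\le c_1\|f\|_{W_{s'}^\infty},\qquad \|f\|_{W_{s'}^\infty}\le c_2\|f\|_{W_s^p}.$$ In particular $\|f\|_\infty\le c_1c_2\|f\|_{W_s^p}$. -/

import Mathlib

open MeasureTheory
open scoped ENNReal

noncomputable section

namespace PeriodicSobolev

instance fact_two_pi_pos : Fact ((0 : ℝ) < 2 * Real.pi) := ⟨Real.two_pi_pos⟩

/-- The `q`-dimensional torus `(ℝ / 2πℤ)^q`.  Functions on it are the `2π`-periodic functions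
on `ℝ^q`, and its `volume` is Lebesgue measure on `[-π, π]^q` (total mass `(2π)^q`). -/
abbrev Torus (q : ℕ) : Type := Fin q → AddCircle (2 * Real.pi)

/-- The Euclidean norm `‖k‖` of a frequency `k ∈ ℤ^q`. -/
def freqNorm {q : ℕ} (k : Fin q → ℤ) : ℝ := Real.sqrt (∑ i, (k i : ℝ) ^ 2)

/-- The exponential `x ↦ exp (i k · x)` on the torus (see `mode_coe`). -/
def mode {q : ℕ} (k : Fin q → ℤ) : C(Torus q, ℂ) where
  toFun x := ∏ i, fourier (k i) (x i)
  continuous_toFun := by fun_prop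

theorem mode_coe {q : ℕ} (k : Fin q → ℤ) (x : Fin q → ℝ) :
    mode k (fun i => (x i : AddCircle (2 * Real.pi))) =
      Complex.exp (Complex.I * ∑ i, (k i : ℂ) * (x i : ℂ)) := by
  have hpi : (Real.pi : ℂ) ≠ 0 := by exact_mod_cast Real.pi_ne_zero
  simp only [mode, ContinuousMap.coe_mk, Finset.mul_sum, Complex.exp_sum, fourier_coe_apply]
  refine Finset.prod_congr rfl fun i _ => ?_
  congr 1
  push_cast
  field_simp

/-- Trigonometric polynomials in `q` variables of spherical order at most `r`. -/
def trigPoly (q : ℕ) (r : ℝ) : Submodule ℂ C(Torus q, ℂ) :=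
  Submodule.span ℂ {T | ∃ k : Fin q → ℤ, freqNorm k ≤ r ∧ T = mode k}

/-- The Fourier coefficient `(2π)^{-q} ∫ f(x) exp (-i k · x) dx`. -/
def coeff {q : ℕ} (f : Torus q → ℂ) (k : Fin q → ℤ) : ℂ :=
  (1 / (2 * Real.pi : ℂ) ^ q) * ∫ x, f x * mode (-k) x

/-- The degree of approximation `E_{r,p}(f) = inf {‖f - T‖_p : T ∈ trigPoly q r}`. -/
def degApprox {q : ℕ} (r : ℝ) (p : ℝ≥0∞) (f : Torus q → ℂ) : ℝ≥0∞ :=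
  ⨅ T ∈ trigPoly q r, eLpNorm (fun x => f x - T x) p volume

/-- `g ∈ L^p` is the derivative `f^{(s)}`: its Fourier coefficients are
`(‖k‖² + 1)^{s/2}` times those of `f`. -/
def IsDeriv {q : ℕ} (s : ℝ) (p : ℝ≥0∞) (f g : Torus q → ℂ) : Prop :=
  MemLp g p volume ∧
    ∀ k : Fin q → ℤ, coeff g k = (((freqNorm k ^ 2 + 1) ^ (s / 2) : ℝ) : ℂ) * coeff f k

/-- Membership in the Sobolev class `W_s^p`. -/
def MemSobolev {q : ℕ} (s : ℝ) (p : ℝ≥0∞) (f : Torus q → ℂ) : Prop :=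
  MemLp f p volume ∧ ∃ g : Torus q → ℂ, IsDeriv s p f g

open scoped Classical in
/-- The derivative `f^{(s)}` of `f ∈ W_s^p`, which is determined up to a null set
(and `0`, a value never used, if there is none). -/
def sobolevDeriv {q : ℕ} (s : ℝ) (p : ℝ≥0∞) (f : Torus q → ℂ) : Torus q → ℂ :=
  if h : ∃ g : Torus q → ℂ, IsDeriv s p f g then h.choose else 0

theorem MemSobolev.isDeriv {q : ℕ} {s : ℝ} {p : ℝ≥0∞} {f : Torus q → ℂ}
    (h : MemSobolev s p f) : IsDeriv s p f (sobolevDeriv s p f) := by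
  rw [sobolevDeriv, dif_pos h.2]
  exact h.2.choose_spec

/-- The Sobolev norm `‖f‖_{W_s^p} = ‖f^{(s)}‖_p`, for `f ∈ W_s^p`. -/
def sobolevNorm {q : ℕ} (s : ℝ) (p : ℝ≥0∞) (f : Torus q → ℂ) : ℝ≥0∞ :=
  eLpNorm (sobolevDeriv s p f) p volume

end PeriodicSobolev

end

open MeasureTheory
open scoped ENNReal

noncomputable section

namespace PeriodicSobolev

variable {q : ℕ}

/-! Everything follows from one fact: the Bessel kernel $K$ with coefficients $(\|k\|^2+1)^{-s/2}$
lies in $L^{p'}$ and is approximated there by trigonometric polynomials of order $2^n$ with error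
$O(2^{-n(s-q/p)})$. Convolution with $g\in L^p$ then turns this, by Hölder, into a uniform estimate:
$K*g$ is a uniform limit of trigonometric polynomials, hence continuous, with the required rate. If
$g=f^{(s)}$, then $f$ and $K*g$ have the same Fourier coefficients and so agree almost everywhere
(`ae_eq_of_coeff_eq`).

The kernel is the limit of its smooth truncations `kernelPoly` at frequencies $2^n$. A dyadic block
has sup norm $O(N^{q-s})$ by counting frequencies (`norm_kernelPoly_block_le`) and $L^1$ norm
$O(N^{-s})$ (`exists_eLpNorm_one_kernelPoly_block_le`). Interpolation gives $O(N^{-(s-q/p)})$ in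
$L^{p'}$, and the blocks sum geometrically because $s>q/p$.

The $L^1$ bound is the hard part. The Gamma integral writes a Bessel block as an average over $t$ of
heat-kernel blocks. Gaussian and cutoff both factor over coordinates, so a heat block is a
difference of products of one-dimensional sums, whose $L^1$ norms are controlled by a
Carlson–Bernstein inequality. The frequencies of a block are of size at least about $N$, which
yields the decay $e^{-cN^2t}$. -/

/-! ### Characters of the torus and their orthogonality. -/

theorem mode_apply (k : Fin q → ℤ) (x : Torus q) : mode k x = ∏ i, fourier (k i) (x i) := rfl

theorem norm_mode_apply (k : Fin q → ℤ) (x : Torus q) : ‖mode k x‖ = 1 := by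
  simp [mode_apply, fourier_apply, Circle.norm_coe]

theorem mode_zero : mode (0 : Fin q → ℤ) = 1 := by
  ext x; simp [mode_apply]

theorem mode_add_index (k l : Fin q → ℤ) (x : Torus q) :
    mode (k + l) x = mode k x * mode l x := by
  simp [mode_apply, Finset.prod_mul_distrib]

theorem mode_add (k : Fin q → ℤ) (x y : Torus q) : mode k (x + y) = mode k x * mode k y := by
  simp only [mode_apply, ← Finset.prod_mul_distrib]
  refine Finset.prod_congr rfl fun i _ => ?_
  simp [fourier_apply, smul_add, AddCircle.toCircle_add]

theorem mode_neg_index (k : Fin q → ℤ) (x : Torus q) : mode (-k) x = star (mode k x) := by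
  simp [mode_apply]

theorem mode_neg (k : Fin q → ℤ) (x : Torus q) : mode k (-x) = mode (-k) x := by
  simp [mode_apply, fourier_apply]

theorem mode_sub (k : Fin q → ℤ) (x y : Torus q) : mode k (x - y) = mode k x * mode (-k) y := by
  rw [sub_eq_add_neg, mode_add, mode_neg]

theorem integral_fourier (n : ℤ) :
    ∫ x : AddCircle (2 * Real.pi), fourier n x = if n = 0 then (2 * Real.pi : ℂ) else 0 := by
  split_ifs with h
  · subst h
    simp [Measure.real, AddCircle.measure_univ, Real.pi_pos.le]
  · exact integral_eq_zero_of_add_right_eq_neg (fourier_add_half_inv_index h Real.two_pi_pos)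

theorem integral_mode (k : Fin q → ℤ) :
    ∫ x, mode k x = if k = 0 then (2 * Real.pi : ℂ) ^ q else 0 := by
  simp only [mode_apply]
  rw [integral_fintype_prod_volume_eq_prod (f := fun i y => fourier (k i) y)]
  simp only [integral_fourier]
  split_ifs with h
  · simp [h]
  · obtain ⟨i, hi⟩ := Function.ne_iff.mp h
    exact Finset.prod_eq_zero (Finset.mem_univ i) (by simpa using hi)

theorem two_pi_pow_ne_zero (q : ℕ) : (2 * Real.pi : ℂ) ^ q ≠ 0 :=
  pow_ne_zero _ (mul_ne_zero two_ne_zero (by exact_mod_cast Real.pi_ne_zero))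

theorem coeff_mode (k l : Fin q → ℤ) : coeff (mode k) l = if k = l then 1 else 0 := by
  simp only [coeff, ← mode_add_index, integral_mode, ← sub_eq_add_neg, sub_eq_zero]
  have := two_pi_pow_ne_zero q
  split_ifs <;> simp [this]


/-! ### Uniqueness of Fourier coefficients in $L^1$. -/

theorem mode_single (z : Torus q) (i : Fin q) :
    mode (Pi.single i 1) z = fourier 1 (z i) := by
  rw [mode_apply, Finset.prod_eq_single i]
  · simp
  · intro j _ hj; simp [Pi.single_eq_of_ne hj]
  · simp

/-- The star algebra of all trigonometric polynomials. -/
def modeSubalgebra (q : ℕ) : StarSubalgebra ℂ C(Torus q, ℂ) where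
  toSubalgebra := Algebra.adjoin ℂ (Set.range mode)
  star_mem' := by
    change Algebra.adjoin ℂ (Set.range mode) ≤ star (Algebra.adjoin ℂ (Set.range mode))
    refine Algebra.adjoin_le ?_
    rintro _ ⟨n, rfl⟩
    refine Algebra.subset_adjoin ⟨-n, ?_⟩
    ext1 x
    simp only [mode_neg_index, ContinuousMap.star_apply]

theorem modeSubalgebra_coe :
    (modeSubalgebra q).toSubalgebra.toSubmodule = Submodule.span ℂ (Set.range mode) := by
  apply Algebra.adjoin_eq_span_of_subset
  refine .trans (fun x ↦ Submonoid.closure_induction (fun _ ↦ id) ⟨0, mode_zero⟩ ?_)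
    Submodule.subset_span
  rintro _ _ _ _ ⟨m, rfl⟩ ⟨n, rfl⟩
  exact ⟨m + n, by ext z; exact mode_add_index m n z⟩

theorem modeSubalgebra_separatesPoints : (modeSubalgebra q).SeparatesPoints := by
  intro x y hxy
  obtain ⟨i, hi⟩ := Function.ne_iff.mp hxy
  refine ⟨_, ⟨mode (Pi.single i 1), Algebra.subset_adjoin ⟨Pi.single i 1, rfl⟩, rfl⟩, ?_⟩
  dsimp only
  rw [mode_single, mode_single, fourier_one, fourier_one, Ne, Circle.coe_inj]
  contrapose hi
  exact AddCircle.injective_toCircle Real.two_pi_pos.ne' hi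

theorem span_mode_closure_eq_top :
    (Submodule.span ℂ (Set.range (mode (q := q)))).topologicalClosure = ⊤ := by
  rw [← modeSubalgebra_coe]
  exact congr_arg (Subalgebra.toSubmodule <| StarSubalgebra.toSubalgebra ·)
    (ContinuousMap.starSubalgebra_topologicalClosure_eq_top_of_separatesPoints _
      modeSubalgebra_separatesPoints)

/-- Pairing with $h$ is continuous in the sup norm, so its kernel is closed; it contains all
exponentials, whose span is dense by Stone–Weierstrass. -/
theorem integral_mul_continuous_eq_zero {h : Torus q → ℂ} (hh : Integrable h)
    (h0 : ∀ k, coeff h k = 0) (φ : C(Torus q, ℂ)) : ∫ x, h x * φ x = 0 := by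
  have hint (φ : C(Torus q, ℂ)) : Integrable fun x => h x * φ x :=
    hh.mul_bdd φ.continuous.aestronglyMeasurable (.of_forall (φ.norm_coe_le_norm ·))
  let Λ : C(Torus q, ℂ) →ₗ[ℂ] ℂ :=
    { toFun φ := ∫ x, h x * φ x
      map_add' φ ψ := by
        simp only [ContinuousMap.add_apply, mul_add]; exact integral_add (hint _) (hint _)
      map_smul' c φ := by
        simp only [ContinuousMap.smul_apply, smul_eq_mul, mul_left_comm, integral_const_mul,
          RingHom.id_apply] }
  let Λ' : C(Torus q, ℂ) →L[ℂ] ℂ := Λ.mkContinuous (∫ x, ‖h x‖) fun φ => by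
    refine (norm_integral_le_integral_norm _).trans ?_
    rw [← integral_mul_const]
    refine integral_mono (hint φ).norm (hh.norm.mul_const _) fun x => ?_
    simpa only [norm_mul] using mul_le_mul_of_nonneg_left (φ.norm_coe_le_norm x) (norm_nonneg _)
  have hle : (Submodule.span ℂ (Set.range (mode (q := q)))).topologicalClosure ≤
      LinearMap.ker Λ'.toLinearMap := by
    refine Submodule.topologicalClosure_minimal _ (Submodule.span_le.mpr ?_)
      (ContinuousLinearMap.isClosed_ker Λ')
    rintro _ ⟨k, rfl⟩
    have := h0 (-k)
    simp only [coeff, neg_neg, mul_eq_zero, one_div, inv_eq_zero, two_pi_pow_ne_zero,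
      false_or] at this
    exact this
  rw [span_mode_closure_eq_top] at hle
  exact hle (Submodule.mem_top : φ ∈ ⊤)

/-- The indicator of a closed set is a bounded pointwise limit of continuous functions, so dominated
convergence makes the integral of $h$ over every closed set vanish. -/
theorem ae_eq_zero_of_coeff_eq_zero {h : Torus q → ℂ} (hh : Integrable h)
    (h0 : ∀ k, coeff h k = 0) : h =ᵐ[volume] 0 := by
  refine ae_eq_zero_of_forall_setIntegral_isClosed_eq_zero hh fun S hS => ?_
  have hlim : Filter.Tendsto (fun n : ℕ => ∫ x, h x * ((hS.apprSeq n x : ℝ) : ℂ)) Filter.atTop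
      (nhds (∫ x, S.indicator h x)) := by
    refine tendsto_integral_of_dominated_convergence (fun x => ‖h x‖) (fun n => ?_) hh.norm
      (fun n => .of_forall fun x => ?_) (.of_forall fun x => ?_)
    · have : Continuous fun x => ((hS.apprSeq n x : ℝ) : ℂ) := by fun_prop
      exact hh.1.mul this.aestronglyMeasurable
    · rw [norm_mul]
      refine mul_le_of_le_one_right (norm_nonneg _) ?_
      simpa using HasOuterApproxClosed.apprSeq_apply_le_one hS n x
    · have h1 := tendsto_pi_nhds.mp (HasOuterApproxClosed.tendsto_apprSeq hS) x
      have h2 : Filter.Tendsto (fun n : ℕ => h x * ((hS.apprSeq n x : ℝ) : ℂ)) Filter.atTop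
          (nhds (h x * (((S.indicator (fun _ => (1 : NNReal)) x : NNReal) : ℝ) : ℂ))) := by
        refine Filter.Tendsto.const_mul _ ?_
        exact ((Complex.continuous_ofReal.comp NNReal.continuous_coe).tendsto _).comp h1
      convert h2 using 2
      by_cases hx : x ∈ S <;> simp [hx]
  have hz (n : ℕ) : ∫ x, h x * ((hS.apprSeq n x : ℝ) : ℂ) = 0 :=
    integral_mul_continuous_eq_zero hh h0
      ⟨fun x => ((hS.apprSeq n x : ℝ) : ℂ), by fun_prop⟩
  simp only [hz] at hlim
  rw [← integral_indicator hS.measurableSet]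
  exact (tendsto_nhds_unique tendsto_const_nhds hlim).symm

theorem integrable_mul_mode {f : Torus q → ℂ} (hf : Integrable f) (k : Fin q → ℤ) :
    Integrable fun x => f x * mode k x :=
  hf.mul_bdd (mode k).continuous.aestronglyMeasurable
    (.of_forall fun x => (norm_mode_apply k x).le)

theorem coeff_sub {f g : Torus q → ℂ} (hf : Integrable f) (hg : Integrable g) (k : Fin q → ℤ) :
    coeff (fun x => f x - g x) k = coeff f k - coeff g k := by
  simp only [coeff, sub_mul]
  rw [integral_sub (integrable_mul_mode hf _) (integrable_mul_mode hg _), mul_sub]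

theorem coeff_congr_ae {f g : Torus q → ℂ} (h : f =ᵐ[volume] g) (k : Fin q → ℤ) :
    coeff f k = coeff g k := by
  rw [coeff, coeff]
  congr 1
  exact integral_congr_ae (h.mono fun x hx => by simp only [hx])

theorem ae_eq_of_coeff_eq {f g : Torus q → ℂ} (hf : Integrable f) (hg : Integrable g)
    (h : ∀ k, coeff f k = coeff g k) : f =ᵐ[volume] g := by
  have := ae_eq_zero_of_coeff_eq_zero (hf.sub hg) fun k => by
    have := coeff_sub hf hg k
    rw [h k, sub_self] at this
    exact this
  filter_upwards [this] with x hx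
  exact sub_eq_zero.mp hx

theorem norm_coeff_le (f : Torus q → ℂ) (k : Fin q → ℤ) :
    ‖coeff f k‖ ≤ (1 / (2 * Real.pi) ^ q) * ∫ x, ‖f x‖ := by
  rw [coeff, norm_mul]
  have : ‖(1 / (2 * Real.pi : ℂ) ^ q)‖ = 1 / (2 * Real.pi) ^ q := by
    simp [abs_of_pos Real.pi_pos]
  rw [this]
  refine mul_le_mul_of_nonneg_left ((norm_integral_le_integral_norm _).trans_eq ?_) (by positivity)
  simp only [norm_mul, norm_mode_apply, mul_one]

theorem coeff_sum_mode (S : Finset (Fin q → ℤ)) (c : (Fin q → ℤ) → ℂ) (l : Fin q → ℤ) :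
    coeff (fun x => ∑ k ∈ S, c k * mode k x) l = if l ∈ S then c l else 0 := by
  have : coeff (fun x => ∑ k ∈ S, c k * mode k x) l = ∑ k ∈ S, c k * coeff (mode k) l := by
    simp only [coeff, Finset.sum_mul, mul_assoc]
    rw [integral_finsetSum]
    · simp only [integral_const_mul, Finset.mul_sum, mul_left_comm]
    · intro k _
      refine Integrable.const_mul ?_ _
      exact (integrable_mul_mode (f := mode k) ((mode k).continuous.integrable_of_hasCompactSupport
        (HasCompactSupport.of_compactSpace _)) _)
  simp [this, coeff_mode]

instance isNegInvariant_volume_torus (q : ℕ) : (volume : Measure (Torus q)).IsNegInvariant :=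
  Pi.isNegInvariant_volume

theorem continuous_integrable {X : Type*} [TopologicalSpace X] [CompactSpace X]
    [MeasurableSpace X] [OpensMeasurableSpace X] {E : Type*} [NormedAddCommGroup E]
    [SecondCountableTopologyEither X E] {μ : Measure X} [IsFiniteMeasureOnCompacts μ]
    {f : X → E} (hf : Continuous f) : Integrable f μ :=
  hf.integrable_of_hasCompactSupport (HasCompactSupport.of_compactSpace f)

/-! ### $L^1$ norms of one-dimensional trigonometric sums. -/

/-- A one-dimensional trigonometric sum over `S` with real coefficients `a`. -/
def fourierSum (S : Finset ℤ) (a : ℤ → ℝ) (x : AddCircle (2 * Real.pi)) : ℂ :=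
  ∑ k ∈ S, (a k : ℂ) * fourier k x

theorem continuous_fourierSum (S : Finset ℤ) (a : ℤ → ℝ) : Continuous (fourierSum S a) := by
  unfold fourierSum; fun_prop

theorem fourierSum_congr {S S' : Finset ℤ} {a : ℤ → ℝ} (h : S ⊆ S')
    (h0 : ∀ k ∈ S', k ∉ S → a k = 0) : fourierSum S a = fourierSum S' a := by
  ext x
  exact Finset.sum_subset h fun k hk hk' => by simp [h0 k hk hk']

/-- Parseval's identity for a finite sum. -/
theorem integral_norm_sq_fourierSum (S : Finset ℤ) (a : ℤ → ℝ) :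
    ∫ x, ‖fourierSum S a x‖ ^ 2 = 2 * Real.pi * ∑ k ∈ S, a k ^ 2 := by
  have h1 (x : AddCircle (2 * Real.pi)) : ((‖fourierSum S a x‖ ^ 2 : ℝ) : ℂ) =
      ∑ k ∈ S, ∑ l ∈ S, ((a k : ℂ) * a l) * fourier (k - l) x := by
    rw [← Complex.normSq_eq_norm_sq, ← Complex.mul_conj]
    simp only [fourierSum, map_sum, map_mul, Complex.conj_ofReal, Finset.sum_mul_sum]
    refine Finset.sum_congr rfl fun k _ => Finset.sum_congr rfl fun l _ => ?_
    rw [sub_eq_add_neg, fourier_add, fourier_neg]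
    ring
  have h2 : ((∫ x, ‖fourierSum S a x‖ ^ 2 : ℝ) : ℂ) =
      ((2 * Real.pi * ∑ k ∈ S, a k ^ 2 : ℝ) : ℂ) := by
    rw [← integral_complex_ofReal]
    simp only [h1]
    rw [integral_finsetSum _ fun k _ => continuous_integrable (by fun_prop)]
    push_cast
    rw [Finset.mul_sum]
    refine Finset.sum_congr rfl fun k hk => ?_
    rw [integral_finsetSum _ fun k _ => continuous_integrable (by fun_prop)]
    simp only [integral_const_mul, integral_fourier, sub_eq_zero]
    simp [hk]
    ring
  exact_mod_cast h2

/-- Summation by parts. The shift by one frequency is why the range on the right extends to $M+1$.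
-/
theorem fourier_one_sub_one_mul_fourierSum {M : ℕ} {a : ℤ → ℝ}
    (ha : ∀ k : ℤ, (M : ℤ) < |k| → a k = 0) (x : AddCircle (2 * Real.pi)) :
    (fourier 1 x - 1) * fourierSum (Finset.Icc (-M) M) a x =
      fourierSum (Finset.Icc (-M) (M + 1)) (fun k => a (k - 1) - a k) x := by
  have h1 : fourierSum (Finset.Icc (-M) M) a = fourierSum (Finset.Icc (-M) (M + 1)) a := by
    refine fourierSum_congr (Finset.Icc_subset_Icc_right (by lia)) fun k hk hk' => ha k ?_
    simp only [Finset.mem_Icc] at hk hk'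
    rw [lt_abs]; lia
  have h2 : fourier 1 x * fourierSum (Finset.Icc (-M) M) a x =
      fourierSum (Finset.Icc (-M + 1) (M + 1)) (fun k => a (k - 1)) x := by
    simp only [fourierSum]
    have : Finset.Icc (-(M : ℤ) + 1) (M + 1) =
        (Finset.Icc (-(M : ℤ)) M).map (addRightEmbedding 1) := by
      simp
    rw [this, Finset.sum_map, Finset.mul_sum]
    refine Finset.sum_congr rfl fun k _ => ?_
    simp only [addRightEmbedding_apply, add_sub_cancel_right]
    rw [fourier_add]
    ring
  have h3 : fourierSum (Finset.Icc (-M + 1) (M + 1)) (fun k => a (k - 1)) =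
      fourierSum (Finset.Icc (-M) (M + 1)) (fun k => a (k - 1)) := by
    refine fourierSum_congr (Finset.Icc_subset_Icc_left (by lia)) fun k hk hk' => ha _ ?_
    simp only [Finset.mem_Icc] at hk hk'
    rw [lt_abs]; lia
  rw [sub_mul, one_mul, h2, h3, h1, fourierSum, fourierSum, fourierSum, ← Finset.sum_sub_distrib]
  refine Finset.sum_congr rfl fun k _ => ?_
  push_cast; ring

theorem norm_fourier_one_sub_one (x : ℝ) (h1 : -Real.pi ≤ x) (h2 : x ≤ Real.pi) :
    2 / Real.pi * |x| ≤ ‖(fourier 1 (x : AddCircle (2 * Real.pi)) : ℂ) - 1‖ := by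
  have : (fourier 1 (x : AddCircle (2 * Real.pi)) : ℂ) = Complex.exp (Complex.I * x) := by
    rw [fourier_coe_apply]
    congr 1
    have hpi : (Real.pi : ℂ) ≠ 0 := by exact_mod_cast Real.pi_ne_zero
    push_cast; field_simp
  rw [this, Complex.norm_exp_I_mul_ofReal_sub_one, norm_mul, Real.norm_eq_abs, Real.norm_eq_abs]
  have h3 : 2 / Real.pi * |x / 2| ≤ |Real.sin (x / 2)| := by
    refine Real.mul_abs_le_abs_sin ?_
    rw [abs_le]; constructor <;> linarith
  rw [abs_div, abs_two] at h3
  rw [abs_two]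
  linarith

/-- On $[-\pi,\pi]$ one has $|e^{ix}-1|\ge 2|x|/\pi$, so the integrand is dominated by a Cauchy
density on the line. -/
theorem integral_inv_weight_le {M : ℝ} (hM : 0 < M) :
    ∫ x : AddCircle (2 * Real.pi), (1 + M ^ 2 * ‖(fourier 1 x : ℂ) - 1‖ ^ 2)⁻¹ ≤
      Real.pi ^ 2 / (2 * M) := by
  rw [← AddCircle.intervalIntegral_preimage (2 * Real.pi) (-Real.pi)]
  have hle : -Real.pi ≤ -Real.pi + 2 * Real.pi := by linarith [Real.pi_pos]
  rw [intervalIntegral.integral_of_le hle]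
  have hc : 0 < M * (2 / Real.pi) := by have := Real.pi_pos; positivity
  have hint : Integrable fun x : ℝ => (1 + (M * (2 / Real.pi) * x) ^ 2)⁻¹ :=
    integrable_inv_one_add_sq.comp_mul_left' hc.ne'
  calc ∫ x in Set.Ioc (-Real.pi) (-Real.pi + 2 * Real.pi),
        (1 + M ^ 2 * ‖(fourier 1 (x : AddCircle (2 * Real.pi)) : ℂ) - 1‖ ^ 2)⁻¹
      ≤ ∫ x in Set.Ioc (-Real.pi) (-Real.pi + 2 * Real.pi),
        (1 + (M * (2 / Real.pi) * x) ^ 2)⁻¹ := by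
        refine setIntegral_mono_on ?_ hint.integrableOn measurableSet_Ioc fun x hx => ?_
        · refine Continuous.integrableOn_Ioc ?_
          refine Continuous.inv₀ ?_ fun x => by positivity
          have : Continuous fun x : ℝ => (fourier 1 (x : AddCircle (2 * Real.pi)) : ℂ) :=
            (fourier 1).continuous.comp (AddCircle.continuous_mk' _)
          fun_prop
        · have h := norm_fourier_one_sub_one x hx.1.le (by linarith [hx.2])
          refine inv_anti₀ (by positivity) ?_
          have h' : (2 / Real.pi * |x|) ^ 2 ≤
              ‖(fourier 1 (x : AddCircle (2 * Real.pi)) : ℂ) - 1‖ ^ 2 :=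
            pow_le_pow_left₀ (by have := Real.pi_pos; positivity) h 2
          rw [mul_pow, sq_abs] at h'
          have : (M * (2 / Real.pi) * x) ^ 2 = M ^ 2 * ((2 / Real.pi) ^ 2 * x ^ 2) := by ring
          rw [this]
          gcongr
    _ ≤ ∫ x : ℝ, (1 + (M * (2 / Real.pi) * x) ^ 2)⁻¹ :=
        setIntegral_le_integral hint (.of_forall fun x => by positivity)
    _ = Real.pi ^ 2 / (2 * M) := by
        rw [Measure.integral_comp_mul_left (fun x : ℝ => (1 + x ^ 2)⁻¹),
          integral_univ_inv_one_add_sq, abs_of_pos (inv_pos.mpr hc), smul_eq_mul]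
        have := Real.pi_ne_zero
        field_simp

/-- The weight splits the integral into the energy of the sum and $M^2$ times that of its difference
sequence. Parseval gives $2\pi\big((2M+1)+(2M+2)\big)A^2$, and $4M+3\le 7M$. -/
theorem integral_norm_sq_mul_weight_le {M : ℕ} (hM : 1 ≤ M) {a : ℤ → ℝ} {A : ℝ}
    (ha : ∀ k : ℤ, (M : ℤ) < |k| → a k = 0) (hb : ∀ k, |a k| ≤ A)
    (hd : ∀ k, |a (k - 1) - a k| ≤ A / M) :
    ∫ x, ‖fourierSum (Finset.Icc (-M) M) a x‖ ^ 2 *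
      (1 + M ^ 2 * ‖(fourier 1 x : ℂ) - 1‖ ^ 2) ≤ 14 * Real.pi * M * A ^ 2 := by
  have hM' : (1 : ℝ) ≤ M := by exact_mod_cast hM
  have hM0 : (0 : ℝ) < M := by linarith
  have he (x) : ‖fourierSum (Finset.Icc (-M) M) a x‖ ^ 2 *
      (1 + M ^ 2 * ‖(fourier 1 x : ℂ) - 1‖ ^ 2) =
      ‖fourierSum (Finset.Icc (-M) M) a x‖ ^ 2 + M ^ 2 *
      ‖fourierSum (Finset.Icc (-M) (M + 1)) (fun k => a (k - 1) - a k) x‖ ^ 2 := by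
    rw [← fourier_one_sub_one_mul_fourierSum ha, norm_mul]
    ring
  simp only [he]
  rw [integral_add (continuous_integrable (by have := continuous_fourierSum; fun_prop))
    (continuous_integrable (by have := continuous_fourierSum; fun_prop)), integral_const_mul,
    integral_norm_sq_fourierSum, integral_norm_sq_fourierSum]
  have h1 : ∑ k ∈ Finset.Icc (-M : ℤ) M, a k ^ 2 ≤ (2 * M + 1) * A ^ 2 := by
    refine (Finset.sum_le_card_nsmul _ _ (A ^ 2) fun k _ => ?_).trans_eq ?_
    · rw [← sq_abs]; exact pow_le_pow_left₀ (abs_nonneg _) (hb k) 2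
    · rw [nsmul_eq_mul, Int.card_Icc]
      have : ((M : ℤ) + 1 - -M).toNat = 2 * M + 1 := by lia
      rw [this]; push_cast; ring
  have h2 : ∑ k ∈ Finset.Icc (-M : ℤ) (M + 1), (a (k - 1) - a k) ^ 2 ≤
      (2 * M + 2) * (A / M) ^ 2 := by
    refine (Finset.sum_le_card_nsmul _ _ ((A / M) ^ 2) fun k _ => ?_).trans_eq ?_
    · rw [← sq_abs]; exact pow_le_pow_left₀ (abs_nonneg _) (hd k) 2
    · rw [nsmul_eq_mul, Int.card_Icc]
      have : ((M : ℤ) + 1 + 1 - -M).toNat = 2 * M + 2 := by lia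
      rw [this]; push_cast; ring
  have h3 : (M : ℝ) ^ 2 * ((2 * M + 2) * (A / M) ^ 2) = (2 * M + 2) * A ^ 2 := by field_simp
  have h4 := mul_le_mul_of_nonneg_left h2 (sq_nonneg (M : ℝ))
  rw [h3] at h4
  have hA2 : (1 : ℝ) * A ^ 2 ≤ M * A ^ 2 := by gcongr
  have hp := Real.pi_pos
  calc _ = 2 * Real.pi * (∑ k ∈ Finset.Icc (-M : ℤ) M, a k ^ 2 +
        M ^ 2 * ∑ k ∈ Finset.Icc (-M : ℤ) (M + 1), (a (k - 1) - a k) ^ 2) := by ring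
    _ ≤ 2 * Real.pi * (7 * (M * A ^ 2)) := by gcongr; linarith
    _ = _ := by ring

/-- Weighted Cauchy–Schwarz in its pointwise arithmetic–geometric form, with $\alpha$ left free for
balancing. -/
theorem integral_norm_le_weighted {X : Type*} [TopologicalSpace X] [CompactSpace X]
    [MeasurableSpace X] [OpensMeasurableSpace X] {μ : Measure X} [IsFiniteMeasure μ]
    {g : X → ℂ} {ω : X → ℝ} (hg : Continuous g) (hωc : Continuous ω) (hω : ∀ x, 0 < ω x)
    {α : ℝ} (hα : 0 < α) :
    ∫ x, ‖g x‖ ∂μ ≤ (1 / 2) * (α * ∫ x, ‖g x‖ ^ 2 * ω x ∂μ + α⁻¹ * ∫ x, (ω x)⁻¹ ∂μ) := by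
  have hpt (x) : ‖g x‖ ≤ (1 / 2) * (α * (‖g x‖ ^ 2 * ω x) + α⁻¹ * (ω x)⁻¹) := by
    have h := hω x
    have h2 : ‖g x‖ ^ 2 * (α * ω x) + (α * ω x)⁻¹ - 2 * ‖g x‖ =
        (α * ω x)⁻¹ * (‖g x‖ * (α * ω x) - 1) ^ 2 := by
      field_simp; ring
    have h3 : 0 ≤ (α * ω x)⁻¹ * (‖g x‖ * (α * ω x) - 1) ^ 2 := by positivity
    rw [← h2, mul_inv] at h3
    linarith
  have hi1 : Integrable (fun x => α * (‖g x‖ ^ 2 * ω x)) μ := continuous_integrable (by fun_prop)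
  have hi2 : Integrable (fun x => α⁻¹ * (ω x)⁻¹) μ :=
    continuous_integrable (continuous_const.mul (hωc.inv₀ fun x => (hω x).ne'))
  refine (integral_mono (continuous_integrable (by fun_prop)) ((hi1.add hi2).const_mul _)
    hpt).trans_eq ?_
  rw [integral_const_mul, integral_add' hi1 hi2, integral_const_mul, integral_const_mul]

/-- A Carlson–Bernstein inequality: the `L¹` norm of a trigonometric sum of degree `M` is bounded
if its coefficients are bounded by `A` and vary by at most `A / M`. -/
theorem integral_norm_fourierSum_le {M : ℕ} (hM : 1 ≤ M) {a : ℤ → ℝ} {A : ℝ} (hA : 0 < A)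
    (ha : ∀ k : ℤ, (M : ℤ) < |k| → a k = 0) (hb : ∀ k, |a k| ≤ A)
    (hd : ∀ k, |a (k - 1) - a k| ≤ A / M) :
    ∫ x, ‖fourierSum (Finset.Icc (-M) M) a x‖ ≤ 30 * A := by
  have hM0 : (0 : ℝ) < M := by exact_mod_cast hM
  have h1 := integral_norm_sq_mul_weight_le hM ha hb hd
  have h2 := integral_inv_weight_le hM0
  have h3 := integral_norm_le_weighted (μ := volume)
    (ω := fun x : AddCircle (2 * Real.pi) => 1 + (M : ℝ) ^ 2 * ‖(fourier 1 x : ℂ) - 1‖ ^ 2)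
    (continuous_fourierSum (Finset.Icc (-M) M) a) (by fun_prop) (fun x => by positivity)
    -- The weighted energy is of order $MA^2$ and the integral of the inverse weight of order $1/M$;
    -- this $\alpha$ makes both contributions of order $A$.
    (α := 1 / (M * A)) (by positivity)
  refine h3.trans ?_
  have h4 := mul_le_mul_of_nonneg_left h1 (by positivity : 0 ≤ 1 / (M * A))
  have h5 := mul_le_mul_of_nonneg_left h2 (by positivity : 0 ≤ (1 / (M * A))⁻¹)
  have h6 : (1 / (M * A)) * (14 * Real.pi * M * A ^ 2) = 14 * Real.pi * A := by field_simp
  have h7 : (1 / (M * A))⁻¹ * (Real.pi ^ 2 / (2 * M)) = Real.pi ^ 2 / 2 * A := by field_simp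
  have h8 : 7 * Real.pi + Real.pi ^ 2 / 4 ≤ 30 := by
    nlinarith [Real.pi_lt_d2, Real.pi_pos]
  rw [h6] at h4
  rw [h7] at h5
  have h9 := mul_le_mul_of_nonneg_right h8 hA.le
  linarith

/-! ### Cutoffs and truncated Gaussian multipliers in one variable. -/

/-- The piecewise linear cutoff, equal to `1` on `[-1, 1]` and to `0` off `[-2, 2]`. -/
def cutoff (x : ℝ) : ℝ := max 0 (min 1 (2 - |x|))

theorem cutoff_nonneg (x : ℝ) : 0 ≤ cutoff x := le_max_left _ _

theorem cutoff_le_one (x : ℝ) : cutoff x ≤ 1 := max_le zero_le_one (min_le_left _ _)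

theorem cutoff_eq_one {x : ℝ} (h : |x| ≤ 1) : cutoff x = 1 := by
  rw [cutoff, min_eq_left (by linarith), max_eq_right zero_le_one]

theorem cutoff_eq_zero {x : ℝ} (h : 2 ≤ |x|) : cutoff x = 0 := by
  rw [cutoff, max_eq_left]
  exact (min_le_right _ _).trans (by linarith)

theorem abs_cutoff_sub_le (x y : ℝ) : |cutoff x - cutoff y| ≤ |x - y| := by
  have h1 := abs_max_sub_max_le_abs (min 1 (2 - |x|)) (min 1 (2 - |y|)) 0
  have h2 := abs_min_sub_min_le_max 1 (2 - |x|) 1 (2 - |y|)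
  have h3 := abs_abs_sub_abs_le_abs_sub x y
  rw [max_comm _ (0 : ℝ), max_comm _ (0 : ℝ)] at h1
  refine h1.trans (h2.trans (max_le (by simp) ?_))
  rw [show 2 - |x| - (2 - |y|) = -(|x| - |y|) by ring, abs_neg]
  exact h3

theorem abs_exp_neg_sub_le {a b E : ℝ} (ha : Real.exp (-a) ≤ E) (hb : Real.exp (-b) ≤ E) :
    |Real.exp (-a) - Real.exp (-b)| ≤ E * |a - b| := by
  wlog h : a ≤ b generalizing a b
  · rw [abs_sub_comm, abs_sub_comm a]; exact this hb ha (le_of_not_ge h)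
  rw [abs_of_nonneg (sub_nonneg.mpr (Real.exp_le_exp.mpr (by linarith))), abs_sub_comm,
    abs_of_nonneg (sub_nonneg.mpr h)]
  have h1 : Real.exp (-b) = Real.exp (-a) * Real.exp (-(b - a)) := by
    rw [← Real.exp_add]; ring_nf
  have h2 := Real.add_one_le_exp (-(b - a))
  calc Real.exp (-a) - Real.exp (-b) = Real.exp (-a) * (1 - Real.exp (-(b - a))) := by
        rw [h1]; ring
    _ ≤ Real.exp (-a) * (b - a) :=
        mul_le_mul_of_nonneg_left (by linarith) (Real.exp_pos _).le
    _ ≤ E * (b - a) := mul_le_mul_of_nonneg_right ha (sub_nonneg.mpr h)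

/-- The Carlson–Bernstein inequality applied to a cutoff Gaussian. A discrete product rule bounds
the variation: $K/M$ comes from the cutoff and $2tM$ from the exponent $tk^2$. -/
theorem integral_norm_fourierSum_gauss_le {M : ℕ} (hM : 1 ≤ M) {t : ℝ} (ht : 0 ≤ t) {ψ : ℤ → ℝ}
    {E K : ℝ} (hE : 0 < E) (hL : 1 ≤ K) (hψ : ∀ k, |ψ k| ≤ 1)
    (hΔ : ∀ k, |ψ (k - 1) - ψ k| ≤ K / M) (h0 : ∀ k : ℤ, (M : ℤ) < |k| → ψ k = 0)
    (he : ∀ k, ψ k ≠ 0 → Real.exp (-(t * k ^ 2)) ≤ E) :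
    ∫ x, ‖fourierSum (Finset.Icc (-M) M) (fun k => ψ k * Real.exp (-(t * k ^ 2))) x‖ ≤
      30 * (E * (K + 2 * t * M ^ 2)) := by
  have hM0 : (0 : ℝ) < M := by exact_mod_cast hM
  have hB : 1 ≤ K + 2 * t * M ^ 2 := by
    have : 0 ≤ 2 * t * M ^ 2 := by positivity
    linarith
  refine integral_norm_fourierSum_le hM (by positivity) (fun k hk => by rw [h0 k hk, zero_mul])
    (fun k => ?_) fun k => ?_
  · by_cases hk : ψ k = 0
    · simp only [hk, zero_mul, abs_zero]; positivity
    · rw [abs_mul, abs_of_pos (Real.exp_pos _)]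
      calc |ψ k| * Real.exp (-(t * k ^ 2)) ≤ 1 * E :=
            mul_le_mul (hψ k) (he k hk) (Real.exp_pos _).le zero_le_one
        _ ≤ E * (K + 2 * t * M ^ 2) := by
            rw [one_mul]; exact le_mul_of_one_le_right hE.le hB
  · have hle : E * (K / M) ≤ E * (K + 2 * t * M ^ 2) / M := by
      rw [← mul_div_assoc]; gcongr
      have : 0 ≤ 2 * t * M ^ 2 := by positivity
      linarith
    -- `E` bounds the exponential only on the support of `ψ`, so the product rule is kept for the
    -- case where both $k-1$ and $k$ lie there. At the edge only one term survives, and its factor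
    -- `ψ` is itself at most $K/M$.
    by_cases hk : ψ k = 0
    · by_cases hk' : ψ (k - 1) = 0
      · simp only [hk, hk', zero_mul, sub_zero, abs_zero]; positivity
      · have h1 := hΔ k
        have h2 := he _ hk'
        rw [hk, sub_zero] at h1
        simp only [hk, zero_mul, sub_zero]
        rw [abs_mul, abs_of_pos (Real.exp_pos _)]
        refine le_trans ?_ hle
        rw [mul_comm]
        exact mul_le_mul h2 h1 (abs_nonneg _) hE.le
    · by_cases hk' : ψ (k - 1) = 0
      · have h1 := hΔ k
        have h2 := he _ hk
        rw [hk', zero_sub, abs_neg] at h1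
        simp only [hk', zero_mul, zero_sub, abs_neg]
        rw [abs_mul, abs_of_pos (Real.exp_pos _)]
        refine le_trans ?_ hle
        rw [mul_comm]
        exact mul_le_mul h2 h1 (abs_nonneg _) hE.le
      · have b1 : |k| ≤ M := not_lt.mp fun h => hk (h0 k h)
        have b2 : |k - 1| ≤ M := not_lt.mp fun h => hk' (h0 _ h)
        have h1 := abs_exp_neg_sub_le (he _ hk') (he _ hk)
        have h2 : |t * ((k - 1 : ℤ) : ℝ) ^ 2 - t * (k : ℝ) ^ 2| ≤ t * (2 * M) := by
          have e1 : t * ((k - 1 : ℤ) : ℝ) ^ 2 - t * (k : ℝ) ^ 2 =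
            t * (((-(k - 1) - k : ℤ)) : ℝ) := by push_cast; ring
          rw [e1, abs_mul, abs_of_nonneg ht]
          gcongr
          have : |-(k - 1) - k| ≤ 2 * (M : ℤ) := by
            rw [abs_le] at b1 b2 ⊢; lia
          exact_mod_cast this
        have e2 : ψ (k - 1) * Real.exp (-(t * ((k - 1 : ℤ) : ℝ) ^ 2)) -
            ψ k * Real.exp (-(t * (k : ℝ) ^ 2)) =
            (ψ (k - 1) - ψ k) * Real.exp (-(t * (k : ℝ) ^ 2)) + ψ (k - 1) *
            (Real.exp (-(t * ((k - 1 : ℤ) : ℝ) ^ 2)) - Real.exp (-(t * (k : ℝ) ^ 2))) := by ring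
        rw [e2]
        refine (abs_add_le _ _).trans ?_
        rw [abs_mul, abs_mul, abs_of_pos (Real.exp_pos _)]
        calc _ ≤ K / M * E + 1 * (E * (t * (2 * M))) := by
              refine add_le_add (mul_le_mul (hΔ k) (he _ hk) (Real.exp_pos _).le (by positivity))
                (mul_le_mul (hψ _) (h1.trans ?_) (abs_nonneg _) zero_le_one)
              gcongr
          _ = _ := by field_simp

/-- The Gaussian multiplier `exp (-t k²)` cut off at frequency `N`. -/
def gaussCut (q N : ℕ) (t : ℝ) (k : ℤ) : ℝ :=
  cutoff (2 * q * k / N) * Real.exp (-(t * k ^ 2))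

theorem cutoff_freq_eq_zero {q N : ℕ} (hq : 1 ≤ q) (hN : 1 ≤ N) {k : ℤ} (hk : (N : ℤ) < |k|) :
    cutoff (2 * q * k / N) = 0 := by
  have hN0 : (0 : ℝ) < N := by exact_mod_cast hN
  have hq0 : (1 : ℝ) ≤ q := by exact_mod_cast hq
  have hk' : (N : ℝ) ≤ |(k : ℝ)| := by exact_mod_cast hk.le
  apply cutoff_eq_zero
  rw [abs_div, abs_of_pos hN0, le_div_iff₀ hN0, abs_mul, abs_of_nonneg (by positivity)]
  nlinarith

theorem cutoff_freq_eq_one {q N : ℕ} (hN : 1 ≤ N) {k : ℤ} (hk : 2 * q * |(k : ℝ)| ≤ N) :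
    cutoff (2 * q * k / N) = 1 := by
  have hN0 : (0 : ℝ) < N := by exact_mod_cast hN
  apply cutoff_eq_one
  rwa [abs_div, abs_of_pos hN0, div_le_one hN0, abs_mul, abs_of_nonneg (by positivity)]

theorem abs_cutoff_freq_sub_le (q N : ℕ) (k : ℤ) :
    |cutoff (2 * q * (k - 1 : ℤ) / N) - cutoff (2 * q * k / N)| ≤ 2 * q / N := by
  refine (abs_cutoff_sub_le _ _).trans_eq ?_
  rw [← sub_div, show (2 * q * ((k - 1 : ℤ) : ℝ) - 2 * q * k) = -(2 * q) by push_cast; ring,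
    abs_div, abs_neg, abs_of_nonneg (by positivity), abs_of_nonneg (by positivity)]

/-- The range $[-2N,2N]$ exceeds the support of the cutoff at $N$; it is chosen to match the cutoff
at $2N$, so that the two sums can be subtracted termwise. -/
theorem integral_norm_gaussCut_le {q N : ℕ} (hq : 1 ≤ q) (hN : 1 ≤ N) {t : ℝ} (ht : 0 ≤ t) :
    ∫ x, ‖fourierSum (Finset.Icc (-(2 * N : ℕ)) (2 * N : ℕ)) (gaussCut q N t) x‖ ≤
      30 * (6 * q + 8 * t * N ^ 2) := by
  have hN0 : (0 : ℝ) < N := by exact_mod_cast hN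
  have hq0 : (1 : ℝ) ≤ q := by exact_mod_cast hq
  refine (integral_norm_fourierSum_gauss_le (M := 2 * N) (by lia) ht (E := 1) (K := 6 * q)
    one_pos (by linarith) (fun k => ?_) (fun k => ?_) (fun k hk => ?_)
    fun k _ => ?_).trans_eq ?_
  · rw [abs_of_nonneg (cutoff_nonneg _)]; exact cutoff_le_one _
  · refine (abs_cutoff_freq_sub_le q N k).trans ?_
    rw [div_le_div_iff₀ hN0 (by push_cast; positivity)]
    push_cast
    nlinarith [mul_pos (show (0:ℝ) < q by linarith) hN0]
  · exact cutoff_freq_eq_zero hq hN (by push_cast at hk; lia)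
  · rw [Real.exp_le_one_iff]; have : 0 ≤ t * (k : ℝ) ^ 2 := by positivity
    linarith
  · push_cast; ring

theorem integral_norm_gaussCut_two_mul_le {q N : ℕ} (hq : 1 ≤ q) (hN : 1 ≤ N) {t : ℝ}
    (ht : 0 ≤ t) :
    ∫ x, ‖fourierSum (Finset.Icc (-(2 * N : ℕ)) (2 * N : ℕ)) (gaussCut q (2 * N) t) x‖ ≤
      30 * (6 * q + 8 * t * N ^ 2) := by
  have hN0 : (0 : ℝ) < N := by exact_mod_cast hN
  have hq0 : (1 : ℝ) ≤ q := by exact_mod_cast hq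
  refine (integral_norm_fourierSum_gauss_le (M := 2 * N) (by lia) ht (E := 1) (K := 6 * q)
    one_pos (by linarith) (fun k => ?_) (fun k => ?_) (fun k hk => ?_)
    fun k _ => ?_).trans_eq ?_
  · rw [abs_of_nonneg (cutoff_nonneg _)]; exact cutoff_le_one _
  · refine (abs_cutoff_freq_sub_le q (2 * N) k).trans ?_
    gcongr; norm_num
  · exact cutoff_freq_eq_zero hq (by lia) hk
  · rw [Real.exp_le_one_iff]; have : 0 ≤ t * (k : ℝ) ^ 2 := by positivity
    linarith
  · push_cast; ring

/-- The two cutoffs agree for $2q|k|\le N$, so only frequencies with $k^2>N^2/(4q^2)$ contribute;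
this gives the exponential factor. The Lipschitz constants add up to $2q/(2N)+2q/N=6q/(2N)$. -/
theorem integral_norm_gaussCut_sub_le {q N : ℕ} (hq : 1 ≤ q) (hN : 1 ≤ N) {t : ℝ}
    (ht : 0 ≤ t) :
    ∫ x, ‖fourierSum (Finset.Icc (-(2 * N : ℕ)) (2 * N : ℕ)) (gaussCut q (2 * N) t) x -
        fourierSum (Finset.Icc (-(2 * N : ℕ)) (2 * N : ℕ)) (gaussCut q N t) x‖ ≤
      30 * (Real.exp (-(t * N ^ 2 / (4 * q ^ 2))) * (6 * q + 8 * t * N ^ 2)) := by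
  have hN0 : (0 : ℝ) < N := by exact_mod_cast hN
  have hq0 : (1 : ℝ) ≤ q := by exact_mod_cast hq
  have hsub (x) : fourierSum (Finset.Icc (-(2 * N : ℕ)) (2 * N : ℕ)) (gaussCut q (2 * N) t) x -
        fourierSum (Finset.Icc (-(2 * N : ℕ)) (2 * N : ℕ)) (gaussCut q N t) x =
      fourierSum (Finset.Icc (-(2 * N : ℕ)) (2 * N : ℕ)) (fun k =>
        (cutoff (2 * q * k / (2 * N : ℕ)) - cutoff (2 * q * k / N)) *
          Real.exp (-(t * k ^ 2))) x := by
    simp only [fourierSum, gaussCut, ← Finset.sum_sub_distrib]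
    refine Finset.sum_congr rfl fun k _ => ?_
    push_cast; ring
  simp only [hsub]
  refine (integral_norm_fourierSum_gauss_le (M := 2 * N) (by lia) ht (K := 6 * q)
    (Real.exp_pos (-(t * N ^ 2 / (4 * q ^ 2)))) (by linarith) (fun k => ?_) (fun k => ?_)
    (fun k hk => ?_) fun k hk => ?_).trans_eq ?_
  · have h1 := cutoff_nonneg (2 * q * k / (2 * N : ℕ))
    have h2 := cutoff_le_one (2 * q * k / (2 * N : ℕ))
    have h3 := cutoff_nonneg (2 * q * k / N)
    have h4 := cutoff_le_one (2 * q * k / N)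
    rw [abs_le]; constructor <;> linarith
  · have h1 := abs_cutoff_freq_sub_le q (2 * N) k
    have h2 := abs_cutoff_freq_sub_le q N k
    have h3 : (2 * q / (2 * N : ℕ) + 2 * q / N : ℝ) = 6 * q / (2 * N : ℕ) := by
      push_cast; field_simp; ring
    rw [← h3]
    rw [abs_le] at h1 h2 ⊢
    constructor <;> linarith [h1.1, h1.2, h2.1, h2.2]
  · rw [cutoff_freq_eq_zero hq (by lia) hk, cutoff_freq_eq_zero hq hN (by push_cast at hk; lia),
      sub_zero]
  · rw [Real.exp_le_exp, neg_le_neg_iff]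
    have : (N : ℝ) < 2 * q * |(k : ℝ)| := by
      by_contra! h
      apply hk
      rw [cutoff_freq_eq_one hN h, cutoff_freq_eq_one (by lia) (by push_cast; linarith), sub_self]
    have h2 : (N : ℝ) ^ 2 ≤ (2 * q * |(k : ℝ)|) ^ 2 := pow_le_pow_left₀ hN0.le this.le 2
    rw [mul_pow, sq_abs] at h2
    rw [div_le_iff₀ (by positivity)]
    calc t * N ^ 2 ≤ t * ((2 * q) ^ 2 * (k : ℝ) ^ 2) := by gcongr
      _ = _ := by ring
  · push_cast; ring

/-! ### From one variable to $q$ variables: blocks of the heat kernel. -/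

/-- Telescoping replaces one factor at a time. Bounding every unchanged factor by $\|a_i\|+\|b_i\|$
keeps each summand a product, which Fubini can then integrate. -/
theorem norm_prod_sub_prod_le {ι : Type*} [DecidableEq ι] (s : Finset ι) (a b : ι → ℂ) :
    ‖∏ i ∈ s, a i - ∏ i ∈ s, b i‖ ≤
      ∑ j ∈ s, ∏ i ∈ s, if i = j then ‖a i - b i‖ else ‖a i‖ + ‖b i‖ := by
  induction s using Finset.induction_on with
  | empty => simp
  | insert m s hm ih =>
    rw [Finset.prod_insert hm, Finset.prod_insert hm, Finset.sum_insert hm,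
      Finset.prod_insert hm, if_pos rfl]
    have e1 : a m * ∏ i ∈ s, a i - b m * ∏ i ∈ s, b i =
      (a m - b m) * ∏ i ∈ s, a i + b m * (∏ i ∈ s, a i - ∏ i ∈ s, b i) := by ring
    rw [e1]
    refine (norm_add_le _ _).trans ?_
    rw [norm_mul, norm_mul]
    refine add_le_add (mul_le_mul_of_nonneg_left ?_ (norm_nonneg _)) ?_
    · rw [norm_prod]
      refine Finset.prod_le_prod (fun _ _ => norm_nonneg _) fun i hi => ?_
      rw [if_neg (by rintro rfl; exact hm hi)]
      linarith [norm_nonneg (b i)]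
    · calc _ ≤ (‖a m‖ + ‖b m‖) * _ :=
            mul_le_mul (by linarith [norm_nonneg (a m)]) ih (norm_nonneg _) (by positivity)
        _ = _ := by
            rw [Finset.mul_sum]
            refine Finset.sum_congr rfl fun j hj => ?_
            rw [Finset.prod_insert hm, if_neg (by rintro rfl; exact hm hj)]

theorem sum_piFinset_prod_mode {q : ℕ} (S : Finset ℤ) (a : ℤ → ℝ) (x : Torus q) :
    ∑ k ∈ Fintype.piFinset fun _ : Fin q => S, ((∏ i, a (k i) : ℝ) : ℂ) * mode k x =
      ∏ i, fourierSum S a (x i) := by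
  simp only [fourierSum, Finset.prod_univ_sum, mode_apply]
  refine Finset.sum_congr rfl fun k _ => ?_
  rw [Finset.prod_mul_distrib]; push_cast; rfl

theorem integral_norm_prod_sub_prod_le {q : ℕ} {f g : AddCircle (2 * Real.pi) → ℂ}
    (hf : Continuous f) (hg : Continuous g) :
    ∫ x : Torus q, ‖∏ i, f (x i) - ∏ i, g (x i)‖ ≤
      q * ((∫ x, ‖f x - g x‖) * (∫ x, (‖f x‖ + ‖g x‖)) ^ (q - 1)) := by
  have hc (j : Fin q) : Continuous fun x : Torus q => ∏ i, if i = j then ‖f (x i) - g (x i)‖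
      else ‖f (x i)‖ + ‖g (x i)‖ := by
    refine continuous_finsetProd _ fun i _ => ?_
    split_ifs <;> fun_prop
  calc ∫ x : Torus q, ‖∏ i, f (x i) - ∏ i, g (x i)‖
      ≤ ∫ x : Torus q, ∑ j, ∏ i, if i = j then ‖f (x i) - g (x i)‖
          else ‖f (x i)‖ + ‖g (x i)‖ :=
        integral_mono (continuous_integrable (by fun_prop))
          (continuous_integrable (continuous_finsetSum _ fun j _ => hc j))
          fun x => norm_prod_sub_prod_le _ _ _
    _ = ∑ j : Fin q, ∏ i, ∫ y, if i = j then ‖f y - g y‖ else ‖f y‖ + ‖g y‖ := by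
        rw [integral_finsetSum _ fun j _ => continuous_integrable (hc j)]
        refine Finset.sum_congr rfl fun j _ => ?_
        exact integral_fintype_prod_volume_eq_prod
          (fun (i : Fin q) y => if i = j then ‖f y - g y‖ else ‖f y‖ + ‖g y‖)
    _ = ∑ j : Fin q, ((∫ x, ‖f x - g x‖) * (∫ x, (‖f x‖ + ‖g x‖)) ^ (q - 1)) := by
        refine Finset.sum_congr rfl fun j _ => ?_
        rw [← Finset.mul_prod_erase _ _ (Finset.mem_univ j)]
        simp only [if_true]
        congr 1
        rw [Finset.prod_congr rfl (g := fun _ => ∫ x, (‖f x‖ + ‖g x‖)), Finset.prod_const,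
          Finset.card_erase_of_mem (Finset.mem_univ j), Finset.card_univ, Fintype.card_fin]
        intro i hi
        simp [Finset.ne_of_mem_erase hi]
    _ ≤ _ := by simp

/-- One term of the exponential series at $c(1+y)$; it serves to absorb polynomial growth into half
of an exponential decay. -/
theorem one_add_pow_le_exp (q : ℕ) {c y : ℝ} (hc : 0 < c) (hy : 0 ≤ y) :
    (1 + y) ^ q ≤ q.factorial / c ^ q * Real.exp c * Real.exp (c * y) := by
  have h := Real.pow_div_factorial_le_exp (c * (1 + y)) (by positivity) q
  rw [div_le_iff₀ (by positivity), mul_pow] at h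
  rw [mul_assoc, ← Real.exp_add, show c + c * y = c * (1 + y) by ring, div_mul_eq_mul_div,
    le_div_iff₀ (by positivity)]
  linarith

/-- The `L¹` norm of a dyadic block of the heat kernel. -/
theorem exists_integral_norm_gauss_block_le {q : ℕ} (hq : 1 ≤ q) :
    ∃ C c : ℝ, 0 < C ∧ 0 < c ∧ ∀ N : ℕ, 1 ≤ N → ∀ t : ℝ, 0 ≤ t →
      ∫ x : Torus q, ‖∏ i, fourierSum (Finset.Icc (-(2 * N : ℕ)) (2 * N : ℕ))
          (gaussCut q (2 * N) t) (x i) -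
        ∏ i, fourierSum (Finset.Icc (-(2 * N : ℕ)) (2 * N : ℕ)) (gaussCut q N t) (x i)‖ ≤
      C * Real.exp (-(c * N ^ 2 * t)) := by
  have hq0 : (1 : ℝ) ≤ q := by exact_mod_cast hq
  -- Half of the available rate $1/(4q^2)$; the other half pays for the factor $(1+y)^q$.
  set c : ℝ := 1 / (8 * q ^ 2)
  have hc : 0 < c := by positivity
  refine ⟨q * (480 * q) ^ q * (q.factorial / c ^ q * Real.exp c), c, by positivity, hc,
    fun N hN t ht => ?_⟩
  have hN0 : (0 : ℝ) < N := by exact_mod_cast hN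
  set S := Finset.Icc (-((2 * N : ℕ) : ℤ)) (2 * N : ℕ)
  have c1 := continuous_fourierSum S (gaussCut q (2 * N) t)
  have c2 := continuous_fourierSum S (gaussCut q N t)
  refine (integral_norm_prod_sub_prod_le c1 c2).trans ?_
  have h1 := integral_norm_gaussCut_sub_le hq hN ht
  have h2 : ∫ x, (‖fourierSum S (gaussCut q (2 * N) t) x‖ + ‖fourierSum S (gaussCut q N t) x‖) ≤
      60 * (6 * q + 8 * t * N ^ 2) := by
    rw [integral_add (continuous_integrable c1.norm) (continuous_integrable c2.norm)]
    linarith [integral_norm_gaussCut_le hq hN ht, integral_norm_gaussCut_two_mul_le hq hN ht]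
  set y := t * (N : ℝ) ^ 2
  have hy : 0 ≤ y := by positivity
  have hB : 60 * (6 * q + 8 * t * N ^ 2) ≤ 480 * q * (1 + y) := by
    have : y ≤ q * y := le_mul_of_one_le_left hy hq0
    have e : 60 * (6 * q + 8 * t * (N : ℝ) ^ 2) = 360 * q + 480 * y := by simp only [y]; ring
    rw [e]; nlinarith
  have hE : Real.exp (-(t * N ^ 2 / (4 * q ^ 2))) = Real.exp (-(2 * (c * y))) := by
    congr 1; simp only [c, y]; field_simp; ring
  rw [hE] at h1
  have h1' : ∫ x, ‖fourierSum S (gaussCut q (2 * N) t) x - fourierSum S (gaussCut q N t) x‖ ≤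
      Real.exp (-(2 * (c * y))) * (480 * q * (1 + y)) := by
    refine h1.trans ?_
    have : 0 ≤ 6 * q + 8 * t * (N : ℝ) ^ 2 := by positivity
    calc _ = Real.exp (-(2 * (c * y))) * (30 * (6 * q + 8 * t * N ^ 2)) := by ring
      _ ≤ _ := mul_le_mul_of_nonneg_left (by linarith) (Real.exp_pos _).le
  calc _ ≤ q * ((Real.exp (-(2 * (c * y))) * (480 * q * (1 + y))) *
        (480 * q * (1 + y)) ^ (q - 1)) := by
        gcongr
        · exact h2.trans hB
    _ = q * (480 * q) ^ q * ((1 + y) ^ q * Real.exp (-(2 * (c * y)))) := by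
        have : (480 * q * (1 + y)) * (480 * q * (1 + y)) ^ (q - 1) =
            (480 * q) ^ q * (1 + y) ^ q := by
          rw [← pow_succ', Nat.sub_add_cancel hq, mul_pow]
        rw [mul_assoc (Real.exp _), this]; ring
    _ ≤ q * (480 * q) ^ q * ((q.factorial / c ^ q * Real.exp c * Real.exp (c * y)) *
          Real.exp (-(2 * (c * y)))) := by
        gcongr
        exact one_add_pow_le_exp q hc hy
    _ = _ := by
        have : Real.exp (c * y) * Real.exp (-(2 * (c * y))) = Real.exp (-(c * N ^ 2 * t)) := by
          rw [← Real.exp_add]; congr 1; simp only [y]; ring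
        rw [← this]; ring

/-! ### Truncated Bessel kernels and their dyadic blocks in $L^\infty$ and $L^1$. -/

theorem freqNorm_sq (k : Fin q → ℤ) : freqNorm k ^ 2 = ∑ i, (k i : ℝ) ^ 2 :=
  Real.sq_sqrt (Finset.sum_nonneg fun _ _ => sq_nonneg _)

/-- The Fourier coefficient `(‖k‖² + 1)^{-s/2}` of the Bessel kernel. -/
def bessel (s : ℝ) (k : Fin q → ℤ) : ℝ := (freqNorm k ^ 2 + 1) ^ (-s / 2)

theorem bessel_nonneg (s : ℝ) (k : Fin q → ℤ) : 0 ≤ bessel s k := by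
  unfold bessel; positivity

theorem bessel_eq_integral {s : ℝ} (hs : 0 < s) (k : Fin q → ℤ) :
    ∫ t in Set.Ioi (0 : ℝ), t ^ (s / 2 - 1) * Real.exp (-((freqNorm k ^ 2 + 1) * t)) =
      Real.Gamma (s / 2) * bessel s k := by
  have h : 0 < freqNorm k ^ 2 + 1 := by positivity
  rw [Real.integral_rpow_mul_exp_neg_mul_Ioi (by linarith) h, bessel, neg_div,
    Real.rpow_neg h.le, one_div, Real.inv_rpow h.le, mul_comm]

theorem integrableOn_rpow_mul_exp {s r : ℝ} (hs : 0 < s) (hr : 0 < r) :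
    IntegrableOn (fun t : ℝ => t ^ (s / 2 - 1) * Real.exp (-(r * t))) (Set.Ioi 0) := by
  -- The integral of a non-integrable function is $0$ by convention, so the nonzero Gamma value
  -- proves integrability.
  refine Integrable.of_integral_ne_zero ?_
  rw [Real.integral_rpow_mul_exp_neg_mul_Ioi (by linarith) hr]
  have := Real.Gamma_pos_of_pos (show 0 < s / 2 by linarith)
  positivity

/-- The product cutoff at frequency `N`. -/
def window (N : ℕ) (k : Fin q → ℤ) : ℝ := ∏ i, cutoff (2 * q * k i / N)

/-- The cube of frequencies with entries in `[-N, N]`. -/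
def box (q N : ℕ) : Finset (Fin q → ℤ) := Fintype.piFinset fun _ => Finset.Icc (-(N : ℤ)) N

theorem window_nonneg (N : ℕ) (k : Fin q → ℤ) : 0 ≤ window N k :=
  Finset.prod_nonneg fun _ _ => cutoff_nonneg _

theorem window_le_one (N : ℕ) (k : Fin q → ℤ) : window N k ≤ 1 :=
  Finset.prod_le_one (fun _ _ => cutoff_nonneg _) fun _ _ => cutoff_le_one _

theorem window_eq_one {N : ℕ} (hN : 1 ≤ N) {k : Fin q → ℤ}
    (hk : ∀ i, 2 * q * |(k i : ℝ)| ≤ N) : window N k = 1 :=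
  Finset.prod_eq_one fun i _ => cutoff_freq_eq_one hN (hk i)

theorem window_eq_zero (hq : 1 ≤ q) {N : ℕ} (hN : 1 ≤ N) {k : Fin q → ℤ} (hk : k ∉ box q N) :
    window N k = 0 := by
  simp only [box, Fintype.mem_piFinset, Finset.mem_Icc, not_forall] at hk
  obtain ⟨i, hi⟩ := hk
  refine Finset.prod_eq_zero (Finset.mem_univ i) (cutoff_freq_eq_zero hq hN ?_)
  rw [lt_abs]; lia

/-- The factor $2q$ inside the cutoff forces $|k_i|\le N/q$, so the supporting cube fits in the
Euclidean ball of radius $N$. -/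
theorem freqNorm_le_of_window_ne_zero (hq : 1 ≤ q) {N : ℕ} (hN : 1 ≤ N) {k : Fin q → ℤ}
    (hk : window N k ≠ 0) : freqNorm k ≤ N := by
  have hN0 : (0 : ℝ) < N := by exact_mod_cast hN
  have hq0 : (1 : ℝ) ≤ q := by exact_mod_cast hq
  have h (i) : (k i : ℝ) ^ 2 ≤ (N / q) ^ 2 := by
    have h1 := Finset.prod_ne_zero_iff.mp hk i (Finset.mem_univ i)
    have h2 : |2 * q * (k i : ℝ) / N| < 2 := by
      by_contra! h; exact h1 (cutoff_eq_zero h)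
    rw [abs_div, abs_of_pos hN0, div_lt_iff₀ hN0, abs_mul, abs_of_nonneg (by positivity)] at h2
    rw [← sq_abs]
    refine pow_le_pow_left₀ (abs_nonneg _) ?_ 2
    rw [le_div_iff₀ (by positivity)]
    linarith
  refine Real.sqrt_le_iff.mpr ⟨hN0.le, ?_⟩
  calc ∑ i, (k i : ℝ) ^ 2 ≤ ∑ _i : Fin q, ((N : ℝ) / q) ^ 2 := Finset.sum_le_sum fun i _ => h i
    _ = N ^ 2 / q := by simp; field_simp
    _ ≤ N ^ 2 := div_le_self (by positivity) hq0

/-- The smoothly truncated Bessel kernel, a trigonometric polynomial of order `N`. -/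
def kernelPoly (q : ℕ) (s : ℝ) (N : ℕ) : C(Torus q, ℂ) :=
  ∑ k ∈ box q N, ((window N k * bessel s k : ℝ) : ℂ) • mode k

theorem kernelPoly_apply (s : ℝ) (N : ℕ) (x : Torus q) :
    kernelPoly q s N x = ∑ k ∈ box q N, ((window N k * bessel s k : ℝ) : ℂ) * mode k x := by
  simp [kernelPoly]

theorem coeff_kernelPoly (hq : 1 ≤ q) (s : ℝ) {N : ℕ} (hN : 1 ≤ N) (k : Fin q → ℤ) :
    coeff (kernelPoly q s N) k = (window N k * bessel s k : ℝ) := by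
  have : (kernelPoly q s N : Torus q → ℂ) =
      fun x => ∑ k ∈ box q N, ((window N k * bessel s k : ℝ) : ℂ) * mode k x :=
    funext (kernelPoly_apply s N)
  rw [this, coeff_sum_mode]
  split_ifs with h
  · rfl
  · rw [window_eq_zero hq hN h]; simp

theorem kernelPoly_block (hq : 1 ≤ q) (s : ℝ) {N : ℕ} (hN : 1 ≤ N) (x : Torus q) :
    kernelPoly q s (2 * N) x - kernelPoly q s N x =
      ∑ k ∈ box q (2 * N), (((window (2 * N) k - window N k) * bessel s k : ℝ) : ℂ) * mode k x := by
  have hsub : box q N ⊆ box q (2 * N) :=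
    Fintype.piFinset_subset _ _ fun _ =>
      Finset.Icc_subset_Icc (by push_cast; lia) (by push_cast; lia)
  have h1 : kernelPoly q s N x =
      ∑ k ∈ box q (2 * N), ((window N k * bessel s k : ℝ) : ℂ) * mode k x := by
    rw [kernelPoly_apply]
    refine Finset.sum_subset hsub fun k _ hk => ?_
    rw [window_eq_zero hq hN hk]; simp
  rw [h1, kernelPoly_apply, ← Finset.sum_sub_distrib]
  refine Finset.sum_congr rfl fun k _ => ?_
  push_cast; ring

/-- Each surviving frequency has a coordinate larger than $N/(2q)$, so its coefficient is at most
$(N/(2q))^{-s}$; there are at most $(4N+1)^q\le(5N)^q$ frequencies. -/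
theorem norm_kernelPoly_block_le (hq : 1 ≤ q) {s : ℝ} (hs : 0 < s) {N : ℕ} (hN : 1 ≤ N)
    (x : Torus q) :
    ‖kernelPoly q s (2 * N) x - kernelPoly q s N x‖ ≤
      5 ^ q * (2 * q : ℝ) ^ s * (N : ℝ) ^ ((q : ℝ) - s) := by
  have hN0 : (0 : ℝ) < N := by exact_mod_cast hN
  have hq0 : (1 : ℝ) ≤ q := by exact_mod_cast hq
  rw [kernelPoly_block hq s hN]
  have hterm : ∀ k ∈ box q (2 * N), ‖(((window (2 * N) k - window N k) * bessel s k : ℝ) : ℂ) *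
      mode k x‖ ≤ (N / (2 * q) : ℝ) ^ (-s) := by
    intro k _
    rw [norm_mul, norm_mode_apply, mul_one, Complex.norm_real, norm_mul, Real.norm_eq_abs,
      Real.norm_eq_abs, abs_of_nonneg (bessel_nonneg s k)]
    by_cases h : ∀ i, 2 * q * |(k i : ℝ)| ≤ N
    · rw [window_eq_one hN h, window_eq_one (by lia) fun i => by push_cast; linarith [h i]]
      simp only [sub_self, abs_zero, zero_mul]; positivity
    · push Not at h
      obtain ⟨i, hi⟩ := h
      have h1 : |window (2 * N) k - window N k| ≤ 1 := by
        rw [abs_le]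
        constructor <;> linarith [window_nonneg (2 * N) k, window_nonneg N k,
          window_le_one (2 * N) k, window_le_one N k]
      have h2 : (N / (2 * q) : ℝ) ^ 2 ≤ freqNorm k ^ 2 + 1 := by
        have h3 : (N / (2 * q) : ℝ) ≤ |(k i : ℝ)| := by
          rw [div_le_iff₀ (by positivity)]; linarith
        have h4 : (N / (2 * q) : ℝ) ^ 2 ≤ (k i : ℝ) ^ 2 := by
          rw [← sq_abs (k i : ℝ)]; exact pow_le_pow_left₀ (by positivity) h3 2
        have h5 : (k i : ℝ) ^ 2 ≤ freqNorm k ^ 2 := by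
          rw [freqNorm_sq]
          exact Finset.single_le_sum (f := fun i => (k i : ℝ) ^ 2) (fun _ _ => sq_nonneg _)
            (Finset.mem_univ i)
        linarith
      calc _ ≤ 1 * bessel s k := by gcongr; exact bessel_nonneg s k
        _ ≤ ((N / (2 * q) : ℝ) ^ 2) ^ (-s / 2) := by
            rw [one_mul]
            exact Real.rpow_le_rpow_of_nonpos (by positivity) h2 (by linarith)
        _ = _ := by
            rw [← Real.rpow_natCast, ← Real.rpow_mul (by positivity)]
            congr 1; push_cast; ring
  refine (norm_sum_le_of_le _ hterm).trans ?_
  have hcard : ((box q (2 * N)).card : ℝ) ≤ (5 * N) ^ q := by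
    have : (box q (2 * N)).card = (4 * N + 1) ^ q := by
      rw [box, Fintype.card_piFinset_const, Int.card_Icc]
      congr 1
      push_cast; lia
    rw [this]; push_cast
    gcongr
    have : (1 : ℝ) ≤ N := by exact_mod_cast hN
    linarith
  rw [Finset.sum_const, nsmul_eq_mul]
  calc _ ≤ (5 * N : ℝ) ^ q * (N / (2 * q) : ℝ) ^ (-s) := by gcongr
    _ = _ := by
      rw [Real.div_rpow hN0.le (by positivity), Real.rpow_neg (by positivity : (0:ℝ) ≤ 2 * q),
        sub_eq_add_neg, Real.rpow_add hN0, Real.rpow_natCast, mul_pow, div_inv_eq_mul]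
      ring

/-- The heat-kernel block whose Laplace-type transform is the block of the Bessel kernel. -/
def heatBlock (q N : ℕ) (t : ℝ) (x : Torus q) : ℂ :=
  ∑ k ∈ box q (2 * N), (((window (2 * N) k - window N k) *
    Real.exp (-(t * freqNorm k ^ 2)) : ℝ) : ℂ) * mode k x

theorem continuous_heatBlock (q N : ℕ) :
    Continuous fun z : ℝ × Torus q => heatBlock q N z.1 z.2 := by
  unfold heatBlock; fun_prop

theorem heatBlock_eq_prod_sub_prod (N : ℕ) (t : ℝ) (x : Torus q) :
    heatBlock q N t x =
      ∏ i, fourierSum (Finset.Icc (-(2 * N : ℕ)) (2 * N : ℕ)) (gaussCut q (2 * N) t) (x i) -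
        ∏ i, fourierSum (Finset.Icc (-(2 * N : ℕ)) (2 * N : ℕ)) (gaussCut q N t) (x i) := by
  rw [← sum_piFinset_prod_mode, ← sum_piFinset_prod_mode, ← Finset.sum_sub_distrib, heatBlock, box]
  refine Finset.sum_congr rfl fun k _ => ?_
  have h (M : ℕ) : ∏ i, gaussCut q M t (k i) = window M k * Real.exp (-(t * freqNorm k ^ 2)) := by
    simp only [gaussCut, Finset.prod_mul_distrib, window, ← Real.exp_sum, freqNorm_sq,
      Finset.mul_sum, Finset.sum_neg_distrib]
  rw [h, h]; push_cast; ring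

/-- Subordination to the heat semigroup: the Gamma integral is applied to each coefficient, and the
$1$ in $\|k\|^2+1$ becomes the factor $e^{-t}$. -/
theorem kernelPoly_block_eq_integral (hq : 1 ≤ q) {s : ℝ} (hs : 0 < s) {N : ℕ} (hN : 1 ≤ N)
    (x : Torus q) :
    (Real.Gamma (s / 2) : ℂ) * (kernelPoly q s (2 * N) x - kernelPoly q s N x) =
      ∫ t in Set.Ioi (0 : ℝ), ((t ^ (s / 2 - 1) * Real.exp (-t) : ℝ) : ℂ) * heatBlock q N t x := by
  have h1 (t : ℝ) : ((t ^ (s / 2 - 1) * Real.exp (-t) : ℝ) : ℂ) * heatBlock q N t x =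
      ∑ k ∈ box q (2 * N), (((window (2 * N) k - window N k : ℝ) : ℂ) * mode k x) *
        ((t ^ (s / 2 - 1) * Real.exp (-((freqNorm k ^ 2 + 1) * t)) : ℝ) : ℂ) := by
    rw [heatBlock, Finset.mul_sum]
    refine Finset.sum_congr rfl fun k _ => ?_
    rw [show -((freqNorm k ^ 2 + 1) * t) = -(t * freqNorm k ^ 2) + -t by ring, Real.exp_add]
    push_cast; ring
  simp only [h1]
  rw [integral_finsetSum _ fun k _ => Integrable.const_mul
    (integrableOn_rpow_mul_exp hs (by positivity)).ofReal _, kernelPoly_block hq s hN,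
    Finset.mul_sum]
  refine Finset.sum_congr rfl fun k _ => ?_
  rw [integral_const_mul, integral_complex_ofReal, bessel_eq_integral hs]
  push_cast; ring

/-- By Tonelli the heat-block bound can be integrated in $t$. With $e^{-t}\le1$ discarded, the Gamma
integral at rate $cN^2$ equals $\Gamma(s/2)(cN^2)^{-s/2}$, which supplies $N^{-s}$. -/
theorem exists_eLpNorm_one_kernelPoly_block_le (hq : 1 ≤ q) {s : ℝ} (hs : 0 < s) :
    ∃ C : ℝ, 0 < C ∧ ∀ N : ℕ, 1 ≤ N →
      eLpNorm (fun x => kernelPoly q s (2 * N) x - kernelPoly q s N x) 1 volume ≤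
        ENNReal.ofReal (C * (N : ℝ) ^ (-s)) := by
  obtain ⟨C, c, hC, hc, hCc⟩ := exists_integral_norm_gauss_block_le hq
  have hG := Real.Gamma_pos_of_pos (show 0 < s / 2 by linarith)
  refine ⟨C * c ^ (-s / 2), by positivity, fun N hN => ?_⟩
  have hN0 : (0 : ℝ) < N := by exact_mod_cast hN
  have hcN : 0 < c * (N : ℝ) ^ 2 := by positivity
  rw [eLpNorm_one_eq_lintegral_enorm]
  have hmeas : AEMeasurable (Function.uncurry fun (x : Torus q) (t : ℝ) =>
      ‖((t ^ (s / 2 - 1) * Real.exp (-t) : ℝ) : ℂ) * heatBlock q N t x‖ₑ)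
      (volume.prod (volume.restrict (Set.Ioi 0))) := by
    refine Measurable.aemeasurable (Measurable.enorm (Measurable.mul ?_ ?_))
    · exact Complex.measurable_ofReal.comp (by fun_prop)
    · exact ((continuous_heatBlock q N).comp continuous_swap).measurable
  have h1 : ENNReal.ofReal (Real.Gamma (s / 2)) *
      ∫⁻ x, ‖kernelPoly q s (2 * N) x - kernelPoly q s N x‖ₑ ≤
      ENNReal.ofReal (Real.Gamma (s / 2)) *
        ENNReal.ofReal (C * c ^ (-s / 2) * (N : ℝ) ^ (-s)) := by
    calc _ = ∫⁻ x, ‖(Real.Gamma (s / 2) : ℂ) *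
          (kernelPoly q s (2 * N) x - kernelPoly q s N x)‖ₑ := by
          rw [← lintegral_const_mul' _ _ ENNReal.ofReal_ne_top]
          refine lintegral_congr fun x => ?_
          rw [enorm_mul, ← ofReal_norm (Real.Gamma (s / 2) : ℂ), Complex.norm_real,
            Real.norm_of_nonneg hG.le]
      _ ≤ ∫⁻ x : Torus q, ∫⁻ t in Set.Ioi (0 : ℝ),
          ‖((t ^ (s / 2 - 1) * Real.exp (-t) : ℝ) : ℂ) * heatBlock q N t x‖ₑ := by
          refine lintegral_mono fun x => ?_
          rw [kernelPoly_block_eq_integral hq hs hN]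
          exact enorm_integral_le_lintegral_enorm _
      _ = ∫⁻ t in Set.Ioi (0 : ℝ), ∫⁻ x : Torus q,
          ‖((t ^ (s / 2 - 1) * Real.exp (-t) : ℝ) : ℂ) * heatBlock q N t x‖ₑ :=
          lintegral_lintegral_swap hmeas
      _ ≤ ∫⁻ t in Set.Ioi (0 : ℝ),
          ENNReal.ofReal (C * (t ^ (s / 2 - 1) * Real.exp (-(c * N ^ 2 * t)))) := by
          refine setLIntegral_mono (by fun_prop) fun t ht => ?_
          have ht0 : 0 < t := ht
          simp only [enorm_mul]
          have hcont : Continuous fun x : Torus q => heatBlock q N t x :=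
            (continuous_heatBlock q N).comp (by fun_prop : Continuous fun x : Torus q => (t, x))
          rw [lintegral_const_mul' _ _ enorm_ne_top, ← ofReal_norm, Complex.norm_real,
            Real.norm_of_nonneg (by positivity),
            ← ofReal_integral_norm_eq_lintegral_enorm (continuous_integrable hcont),
            ← ENNReal.ofReal_mul (by positivity)]
          refine ENNReal.ofReal_le_ofReal ?_
          have h2 := hCc N hN t ht0.le
          simp only [← heatBlock_eq_prod_sub_prod] at h2
          have h3 : Real.exp (-t) ≤ 1 := Real.exp_le_one_iff.mpr (by linarith)
          calc _ ≤ t ^ (s / 2 - 1) * 1 * (C * Real.exp (-(c * N ^ 2 * t))) := by gcongr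
            _ = _ := by ring
      _ = ENNReal.ofReal (∫ t in Set.Ioi (0 : ℝ),
          C * (t ^ (s / 2 - 1) * Real.exp (-(c * N ^ 2 * t)))) := by
          rw [ofReal_integral_eq_lintegral_ofReal
            ((integrableOn_rpow_mul_exp hs hcN).const_mul C)]
          refine (ae_restrict_mem measurableSet_Ioi).mono fun t ht => ?_
          have ht0 : 0 < t := ht
          simp only [Pi.zero_apply]; positivity
      _ = _ := by
          rw [integral_const_mul, Real.integral_rpow_mul_exp_neg_mul_Ioi (by linarith) hcN,
            ← ENNReal.ofReal_mul hG.le]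
          congr 1
          rw [one_div, Real.inv_rpow hcN.le, ← Real.rpow_neg hcN.le,
            Real.mul_rpow hc.le (by positivity), ← Real.rpow_natCast (N : ℝ) 2,
            ← Real.rpow_mul hN0.le, neg_div,
            show ((2 : ℕ) : ℝ) * -(s / 2) = -s by push_cast; ring]
          ring
  exact (ENNReal.mul_le_mul_iff_right (by simpa using hG) ENNReal.ofReal_ne_top).mp h1

/-! ### Interpolation and construction of the kernel in $L^{p'}$. -/

/-- Interpolation between `L¹` and `L^∞`. -/
theorem eLpNorm_le_interpolate {X : Type*} [MeasurableSpace X] {μ : Measure X} {p p' : ℝ≥0∞}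
    [hpp : p.HolderConjugate p'] {g : X → ℂ} {A B : ℝ} (hA : 0 < A) (hB : 0 < B)
    (h1 : eLpNorm g 1 μ ≤ ENNReal.ofReal A) (hb : ∀ x, ‖g x‖ ≤ B) :
    eLpNorm g p' μ ≤ ENNReal.ofReal (A ^ (1 - (p⁻¹).toReal) * B ^ (p⁻¹).toReal) := by
  rcases eq_or_ne p' ∞ with rfl | hp'
  · have hp : p = 1 := (ENNReal.HolderConjugate.eq_top_iff_eq_one ∞ p).mp rfl
    subst hp
    simpa using eLpNormEssSup_le_of_ae_bound (.of_forall hb)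
  have h1p' : 1 ≤ p' := ENNReal.HolderConjugate.one_le p' p
  have hp0 : p' ≠ 0 := (zero_lt_one.trans_le h1p').ne'
  set r := p'.toReal
  have hr : 1 ≤ r := by
    have := ENNReal.toReal_mono hp' h1p'
    simpa using this
  have hpi : (p⁻¹).toReal = 1 - 1 / r := by
    rw [← ENNReal.HolderConjugate.one_sub_inv p' p, ENNReal.toReal_sub_of_le
      (ENNReal.inv_le_one.mpr h1p') ENNReal.one_ne_top, ENNReal.toReal_inv]
    simp [r]
  rw [eLpNorm_eq_lintegral_rpow_enorm_toReal hp0 hp', hpi]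
  have h2 : ∫⁻ x, ‖g x‖ₑ ^ r ∂μ ≤ ENNReal.ofReal (A * B ^ (r - 1)) := by
    calc ∫⁻ x, ‖g x‖ₑ ^ r ∂μ ≤ ∫⁻ x, ‖g x‖ₑ * ENNReal.ofReal (B ^ (r - 1)) ∂μ := by
          refine lintegral_mono fun x => ?_
          rw [← ofReal_norm, ENNReal.ofReal_rpow_of_nonneg (norm_nonneg _) (by linarith),
            ← ENNReal.ofReal_mul (norm_nonneg _)]
          refine ENNReal.ofReal_le_ofReal ?_
          calc ‖g x‖ ^ r = ‖g x‖ ^ (1 + (r - 1)) := by ring_nf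
            _ = ‖g x‖ * ‖g x‖ ^ (r - 1) := by
                rw [Real.rpow_add_of_nonneg (norm_nonneg _) zero_le_one (by linarith),
                  Real.rpow_one]
            _ ≤ ‖g x‖ * B ^ (r - 1) := by
                exact mul_le_mul_of_nonneg_left
                  (Real.rpow_le_rpow (norm_nonneg _) (hb x) (by linarith)) (norm_nonneg _)
      _ = eLpNorm g 1 μ * ENNReal.ofReal (B ^ (r - 1)) := by
          rw [lintegral_mul_const' _ _ ENNReal.ofReal_ne_top, eLpNorm_one_eq_lintegral_enorm]
      _ ≤ ENNReal.ofReal A * ENNReal.ofReal (B ^ (r - 1)) := by gcongr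
      _ = _ := (ENNReal.ofReal_mul hA.le).symm
  calc _ ≤ (ENNReal.ofReal (A * B ^ (r - 1))) ^ (1 / r) := by gcongr
    _ = _ := by
      rw [ENNReal.ofReal_rpow_of_pos (by positivity), Real.mul_rpow hA.le (by positivity),
        ← Real.rpow_mul hB.le]
      congr 3
      · ring
      · field_simp

theorem memLp_continuousMap (f : C(Torus q, ℂ)) (p : ℝ≥0∞) : MemLp f p volume :=
  (memLp_top_of_bound f.continuous.aestronglyMeasurable ‖f‖
    (.of_forall f.norm_coe_le_norm)).mono_exponent le_top

theorem toReal_div_eq (q : ℕ) (p : ℝ≥0∞) :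
    ((q : ℝ≥0∞) / p).toReal = q * (p⁻¹).toReal := by
  rw [div_eq_mul_inv, ENNReal.toReal_mul, ENNReal.toReal_natCast]

/-- With $\theta=1/p$ the exponents combine to $-s(1-\theta)+(q-s)\theta=-(s-q/p)$. -/
theorem exists_eLpNorm_kernelPoly_block_le (hq : 1 ≤ q) {p p' : ℝ≥0∞} [p.HolderConjugate p']
    {s : ℝ} (hs : 0 < s) :
    ∃ C : ℝ, 0 < C ∧ ∀ N : ℕ, 1 ≤ N →
      eLpNorm (fun x => kernelPoly q s (2 * N) x - kernelPoly q s N x) p' volume ≤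
        ENNReal.ofReal (C * (N : ℝ) ^ (-(s - ((q : ℝ≥0∞) / p).toReal))) := by
  obtain ⟨C, hC, h⟩ := exists_eLpNorm_one_kernelPoly_block_le hq hs
  set θ := (p⁻¹).toReal with hθ
  refine ⟨C ^ (1 - θ) * (5 ^ q * (2 * q : ℝ) ^ s) ^ θ, ?_, fun N hN => ?_⟩
  · have : (0 : ℝ) < q := by exact_mod_cast hq
    positivity
  have hq0 : (0 : ℝ) < q := by exact_mod_cast hq
  have hN0 : (0 : ℝ) < N := by exact_mod_cast hN
  refine (eLpNorm_le_interpolate (p := p) (by positivity) (by positivity) (h N hN)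
    (norm_kernelPoly_block_le hq hs hN)).trans_eq ?_
  rw [← hθ, toReal_div_eq, ← hθ, Real.mul_rpow hC.le (by positivity),
    Real.mul_rpow (by positivity) (by positivity), ← Real.rpow_mul hN0.le, ← Real.rpow_mul hN0.le]
  congr 1
  rw [show -(s - q * θ) = -s * (1 - θ) + (q - s) * θ by ring, Real.rpow_add hN0]
  ring

theorem tendsto_coeff {ι : Type*} {l : Filter ι} {f : ι → Torus q → ℂ} {g : Torus q → ℂ}
    (hf : ∀ i, Integrable (f i)) (hg : Integrable g)
    (h : Filter.Tendsto (fun i => eLpNorm (fun x => g x - f i x) 1 volume) l (nhds 0))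
    (k : Fin q → ℤ) : Filter.Tendsto (fun i => coeff (f i) k) l (nhds (coeff g k)) := by
  rw [tendsto_iff_norm_sub_tendsto_zero]
  have h1 : Filter.Tendsto (fun i => (1 / (2 * Real.pi) ^ q) *
      (eLpNorm (fun x => g x - f i x) 1 volume).toReal) l (nhds 0) := by
    simpa using ((ENNReal.tendsto_toReal ENNReal.zero_ne_top).comp h).const_mul
      (1 / (2 * Real.pi) ^ q)
  refine squeeze_zero (fun _ => norm_nonneg _) (fun i => ?_) h1
  rw [norm_sub_rev, ← coeff_sub hg (hf i)]
  refine (norm_coeff_le _ k).trans_eq ?_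
  rw [eLpNorm_one_eq_lintegral_enorm,
    ← integral_norm_eq_lintegral_enorm (f := fun x => g x - f i x) (hg.sub (hf i)).1]

theorem eventually_window_eq_one (k : Fin q → ℤ) :
    ∀ᶠ n : ℕ in Filter.atTop, window (2 ^ n) k = 1 := by
  have h (i : Fin q) : ∀ᶠ n : ℕ in Filter.atTop, 2 * q * |(k i : ℝ)| ≤ (2 : ℝ) ^ n :=
    (tendsto_pow_atTop_atTop_of_one_lt one_lt_two).eventually_ge_atTop _
  filter_upwards [Filter.eventually_all.mpr h] with n hn
  exact window_eq_one Nat.one_le_two_pow fun i => by push_cast; exact hn i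

/-- The truncations at $2^n$ form a Cauchy sequence with geometric ratio $2^{-(s-q/p)}<1$, whose
tail gives the rate. Convergence in $L^{p'}$ implies convergence in $L^1$ on a space of finite
measure, so the coefficients pass to the limit; each one is eventually constant in $n$. -/
theorem exists_besselKernel (hq : 1 ≤ q) {p p' : ℝ≥0∞} [hpp : p.HolderConjugate p'] {s : ℝ}
    (hs : ((q : ℝ≥0∞) / p).toReal < s) :
    ∃ (K : Torus q → ℂ) (C : ℝ), 0 < C ∧ MemLp K p' volume ∧
      (∀ k, coeff K k = (bessel s k : ℂ)) ∧
      ∀ n : ℕ, eLpNorm (fun x => K x - kernelPoly q s (2 ^ n) x) p' volume ≤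
        ENNReal.ofReal (C * (2 : ℝ) ^ (-(n : ℝ) * (s - ((q : ℝ≥0∞) / p).toReal))) := by
  have hs0 : 0 < s := ENNReal.toReal_nonneg.trans_lt hs
  obtain ⟨C, hC, h⟩ := exists_eLpNorm_kernelPoly_block_le (p := p) (p' := p') hq hs0
  set δ := s - ((q : ℝ≥0∞) / p).toReal
  have hδ : 0 < δ := sub_pos.mpr hs
  set r : ℝ := 2 ^ (-δ)
  have hr0 : 0 < r := by positivity
  have hr1 : r < 1 := Real.rpow_lt_one_of_one_lt_of_neg one_lt_two (by linarith)
  have hrn (n : ℕ) : (2 : ℝ) ^ (-(n : ℝ) * δ) = r ^ n := by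
    rw [← Real.rpow_natCast, ← Real.rpow_mul zero_le_two]; congr 1; ring
  have hrn' (n : ℕ) : ((2 ^ n : ℕ) : ℝ) ^ (-δ) = r ^ n := by
    rw [← hrn]; push_cast
    rw [← Real.rpow_natCast, ← Real.rpow_mul zero_le_two]; congr 1; ring
  have h1p' : 1 ≤ p' := ENNReal.HolderConjugate.one_le p' p
  have : Fact (1 ≤ p') := ⟨h1p'⟩
  set f : ℕ → Lp ℂ p' (volume : Measure (Torus q)) := fun n =>
    (memLp_continuousMap (kernelPoly q s (2 ^ n)) p').toLp with hf
  have hdist (n : ℕ) : dist (f n) (f (n + 1)) ≤ C * r ^ n := by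
    rw [dist_comm, dist_edist, Lp.edist_toLp_toLp]
    refine ENNReal.toReal_le_of_le_ofReal (by positivity) ?_
    have := h (2 ^ n) Nat.one_le_two_pow
    rw [hrn', ← pow_succ'] at this
    exact this
  obtain ⟨a, ha⟩ := cauchySeq_tendsto_of_complete (cauchySeq_of_le_geometric r C hr1 hdist)
  have hbound (n : ℕ) : eLpNorm (fun x => a x - kernelPoly q s (2 ^ n) x) p' volume ≤
      ENNReal.ofReal (C / (1 - r) * r ^ n) := by
    have h1 := dist_le_of_le_geometric_of_tendsto r C hr1 hdist ha n
    have h2 : eLpNorm (fun x => a x - kernelPoly q s (2 ^ n) x) p' volume = edist (f n) a := by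
      rw [edist_comm, Lp.edist_def]
      refine eLpNorm_congr_ae ?_
      filter_upwards [(memLp_continuousMap (kernelPoly q s (2 ^ n)) p').coeFn_toLp] with x hx
      simp only [hf, Pi.sub_apply, hx]
    rw [h2, edist_dist]
    refine ENNReal.ofReal_le_ofReal (h1.trans_eq ?_)
    ring
  refine ⟨a, C / (1 - r), div_pos hC (by linarith), Lp.memLp a, fun k => ?_, fun n => ?_⟩
  · have hlim : Filter.Tendsto (fun n : ℕ =>
        eLpNorm (fun x => a x - kernelPoly q s (2 ^ n) x) 1 volume) Filter.atTop (nhds 0) := by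
      set m : ℝ≥0∞ := volume (Set.univ : Set (Torus q)) ^ (1 / (1 : ℝ≥0∞).toReal - 1 / p'.toReal)
      have hm : m ≠ ∞ := by
        refine ENNReal.rpow_ne_top_of_nonneg' ?_ (measure_ne_top _ _)
        exact Measure.measure_univ_pos.mpr (NeZero.ne _)
      have h0 : Filter.Tendsto (fun n : ℕ => ENNReal.ofReal (C / (1 - r) * r ^ n) * m)
          Filter.atTop (nhds 0) := by
        have h3 : Filter.Tendsto (fun n : ℕ => C / (1 - r) * r ^ n) Filter.atTop (nhds 0) := by
          simpa using (tendsto_pow_atTop_nhds_zero_of_lt_one hr0.le hr1).const_mul (C / (1 - r))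
        have h4 := ENNReal.Tendsto.mul_const (ENNReal.tendsto_ofReal h3) (Or.inr hm)
        simpa using h4
      refine tendsto_of_tendsto_of_tendsto_of_le_of_le tendsto_const_nhds h0
        (fun _ => zero_le) fun n => ?_
      refine (eLpNorm_le_eLpNorm_mul_rpow_measure_univ h1p'
        ((Lp.memLp a).1.sub (kernelPoly q s (2 ^ n)).continuous.aestronglyMeasurable)).trans ?_
      gcongr
      exact hbound n
    have hc := tendsto_coeff (fun n => continuous_integrable (kernelPoly q s (2 ^ n)).continuous)
      ((Lp.memLp a).integrable h1p') hlim k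
    refine tendsto_nhds_unique hc (tendsto_const_nhds.congr' ?_)
    filter_upwards [eventually_window_eq_one k] with n hn
    rw [coeff_kernelPoly hq s Nat.one_le_two_pow, hn, one_mul]
  · rw [hrn]; exact hbound n

/-! ### Convolution with the kernel: continuity and approximation. -/

/-- The normalized convolution on the torus. -/
def conv (h g : Torus q → ℂ) (x : Torus q) : ℂ :=
  (1 / (2 * Real.pi : ℂ) ^ q) * ∫ y, h (x - y) * g y

theorem memLp_comp_sub_left {p : ℝ≥0∞} {h : Torus q → ℂ} (hh : MemLp h p volume) (x : Torus q) :
    MemLp (fun y => h (x - y)) p volume :=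
  hh.comp_measurePreserving (Measure.measurePreserving_sub_left volume x)

theorem integrable_conv {p p' : ℝ≥0∞} [p.HolderConjugate p'] {h g : Torus q → ℂ}
    (hh : MemLp h p' volume) (hg : MemLp g p volume) (x : Torus q) :
    Integrable (fun y => h (x - y) * g y) volume :=
  (memLp_comp_sub_left hh x).integrable_mul hg

theorem enorm_conv_le {p p' : ℝ≥0∞} [p.HolderConjugate p'] {h g : Torus q → ℂ}
    (hh : MemLp h p' volume) (hg : MemLp g p volume) (x : Torus q) :
    ‖conv h g x‖ₑ ≤ eLpNorm h p' volume * eLpNorm g p volume := by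
  rw [conv, enorm_mul]
  have h1 : ‖(1 / (2 * Real.pi : ℂ) ^ q)‖ₑ ≤ 1 := by
    rw [← ofReal_norm, ENNReal.ofReal_le_one]
    have : ‖(1 / (2 * Real.pi : ℂ) ^ q)‖ = 1 / (2 * Real.pi) ^ q := by
      simp [abs_of_pos Real.pi_pos]
    rw [this]
    exact div_le_one_of_le₀ (one_le_pow₀ (by linarith [Real.pi_gt_three])) (by positivity)
  calc _ ≤ 1 * ∫⁻ y, ‖h (x - y) * g y‖ₑ :=
        mul_le_mul' h1 (enorm_integral_le_lintegral_enorm _)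
    _ = eLpNorm ((fun y => h (x - y)) • g) 1 volume := by
        rw [one_mul, eLpNorm_one_eq_lintegral_enorm]; rfl
    _ ≤ eLpNorm (fun y => h (x - y)) p' volume * eLpNorm g p volume :=
        eLpNorm_smul_le_mul_eLpNorm hg.1 (memLp_comp_sub_left hh x).1
    _ = _ := by
        congr 1
        exact eLpNorm_comp_measurePreserving hh.1 (Measure.measurePreserving_sub_left volume x)

theorem conv_sub {p p' : ℝ≥0∞} [p.HolderConjugate p'] {h₁ h₂ g : Torus q → ℂ}
    (h1 : MemLp h₁ p' volume) (h2 : MemLp h₂ p' volume) (hg : MemLp g p volume) (x : Torus q) :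
    conv h₁ g x - conv h₂ g x = conv (fun y => h₁ y - h₂ y) g x := by
  simp only [conv, sub_mul]
  rw [integral_sub (integrable_conv h1 hg x) (integrable_conv h2 hg x), mul_sub]

/-- The convolution of `kernelPoly` with `g`, as a trigonometric polynomial. -/
def convPoly (s : ℝ) (N : ℕ) (g : Torus q → ℂ) : C(Torus q, ℂ) :=
  ∑ k ∈ box q N, ((window N k * bessel s k : ℝ) * coeff g k : ℂ) • mode k

theorem convPoly_apply (s : ℝ) (N : ℕ) (g : Torus q → ℂ) (x : Torus q) :
    convPoly s N g x =
      ∑ k ∈ box q N, ((window N k * bessel s k : ℝ) * coeff g k : ℂ) * mode k x := by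
  simp [convPoly]

theorem conv_kernelPoly (s : ℝ) (N : ℕ) {g : Torus q → ℂ} (hg : Integrable g) (x : Torus q) :
    conv (kernelPoly q s N) g x = convPoly s N g x := by
  have h (y : Torus q) : kernelPoly q s N (x - y) * g y = ∑ k ∈ box q N,
      (((window N k * bessel s k : ℝ) : ℂ) * mode k x) * (g y * mode (-k) y) := by
    rw [kernelPoly_apply, Finset.sum_mul]
    refine Finset.sum_congr rfl fun k _ => ?_
    rw [mode_sub]; ring
  rw [conv, convPoly_apply]
  simp only [h]
  rw [integral_finsetSum _ fun k _ => (integrable_mul_mode hg _).const_mul _, Finset.mul_sum]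
  refine Finset.sum_congr rfl fun k _ => ?_
  rw [integral_const_mul, coeff]; ring

theorem convPoly_mem_trigPoly (hq : 1 ≤ q) (s : ℝ) {N : ℕ} (hN : 1 ≤ N) (g : Torus q → ℂ) :
    convPoly s N g ∈ trigPoly q N := by
  refine Submodule.sum_mem _ fun k _ => ?_
  by_cases hk : window N k = 0
  · simp [hk]
  · exact Submodule.smul_mem _ _
      (Submodule.subset_span ⟨k, freqNorm_le_of_window_ne_zero hq hN hk, rfl⟩)

theorem coeff_convPoly (hq : 1 ≤ q) (s : ℝ) {N : ℕ} (hN : 1 ≤ N) (g : Torus q → ℂ)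
    (k : Fin q → ℤ) :
    coeff (convPoly s N g) k = (window N k * bessel s k : ℝ) * coeff g k := by
  rw [show (convPoly s N g : Torus q → ℂ) = _ from funext (convPoly_apply s N g), coeff_sum_mode]
  split_ifs with h
  · rfl
  · rw [window_eq_zero hq hN h]; simp

/-- Hölder turns the $L^{p'}$ rate for the kernel into uniform convergence of the polynomials
`convPoly`. This gives a continuous limit at every point, its coefficients, and the approximants
together. -/
theorem exists_kernel_conv (hq : 1 ≤ q) {p p' : ℝ≥0∞} [hpp : p.HolderConjugate p'] {s : ℝ}
    (hs : ((q : ℝ≥0∞) / p).toReal < s) :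
    ∃ (K : Torus q → ℂ) (C : ℝ), 0 < C ∧ MemLp K p' volume ∧
      (∀ k, coeff K k = (bessel s k : ℂ)) ∧
      ∀ g : Torus q → ℂ, MemLp g p volume → ∃ F : C(Torus q, ℂ), (∀ x, F x = conv K g x) ∧
        (∀ k, coeff F k = bessel s k * coeff g k) ∧
        (∀ x, ‖F x‖ₑ ≤ ENNReal.ofReal C * eLpNorm g p volume) ∧
        ∀ n : ℕ, ∃ T ∈ trigPoly q ((2 : ℝ) ^ n), ∀ x, ‖F x - T x‖ₑ ≤
          ENNReal.ofReal (C * (2 : ℝ) ^ (-(n : ℝ) * (s - ((q : ℝ≥0∞) / p).toReal))) *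
            eLpNorm g p volume := by
  obtain ⟨K, C, hC, hK, hcK, hCK⟩ := exists_besselKernel (p := p) (p' := p') hq hs
  have h1p : 1 ≤ p := ENNReal.HolderConjugate.one_le p p'
  set δ := s - ((q : ℝ≥0∞) / p).toReal
  have hδ : 0 < δ := sub_pos.mpr hs
  -- One constant serves both estimates: `C` for the approximation rate, the norm of `K` for the sup
  -- bound.
  refine ⟨K, max C (eLpNorm K p' volume).toReal, lt_max_of_lt_left hC, hK, hcK, fun g hg => ?_⟩
  have hgi := hg.integrable h1p
  have hconv (n : ℕ) (x : Torus q) : ‖conv K g x - convPoly s (2 ^ n) g x‖ₑ ≤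
      ENNReal.ofReal (C * (2 : ℝ) ^ (-(n : ℝ) * δ)) * eLpNorm g p volume := by
    have hP := memLp_continuousMap (kernelPoly q s (2 ^ n)) p'
    rw [← conv_kernelPoly s _ hgi, conv_sub hK hP hg]
    exact (enorm_conv_le (hK.sub hP) hg x).trans (mul_le_mul_left (hCK n) _)
  set B := (eLpNorm g p volume).toReal
  have hconv' (n : ℕ) (x : Torus q) : ‖conv K g x - convPoly s (2 ^ n) g x‖ ≤
      C * (2 : ℝ) ^ (-(n : ℝ) * δ) * B := by
    have := hconv n x
    rw [← ofReal_norm, ← ENNReal.ofReal_toReal hg.2.ne,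
      ← ENNReal.ofReal_mul (by positivity)] at this
    exact (ENNReal.ofReal_le_ofReal_iff (by positivity)).mp this
  have hlim : Filter.Tendsto (fun n : ℕ => C * (2 : ℝ) ^ (-(n : ℝ) * δ) * B) Filter.atTop
      (nhds 0) := by
    have h1 : Filter.Tendsto (fun n : ℕ => ((2 : ℝ) ^ (-δ)) ^ n) Filter.atTop (nhds 0) :=
      tendsto_pow_atTop_nhds_zero_of_lt_one (by positivity)
        (Real.rpow_lt_one_of_one_lt_of_neg one_lt_two (by linarith))
    have h2 (n : ℕ) : (2 : ℝ) ^ (-(n : ℝ) * δ) = ((2 : ℝ) ^ (-δ)) ^ n := by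
      rw [← Real.rpow_natCast, ← Real.rpow_mul zero_le_two]; congr 1; ring
    simp only [h2]
    simpa using (h1.const_mul C).mul_const B
  have hunif : TendstoUniformly (fun (n : ℕ) x => convPoly s (2 ^ n) g x) (conv K g)
      Filter.atTop := by
    rw [Metric.tendstoUniformly_iff]
    intro ε hε
    filter_upwards [hlim.eventually_lt_const hε] with n hn x
    rw [dist_eq_norm]
    exact (hconv' n x).trans_lt hn
  have hcont : Continuous (conv K g) :=
    hunif.continuous (Filter.Frequently.of_forall fun n => (convPoly s (2 ^ n) g).continuous)
  refine ⟨⟨conv K g, hcont⟩, fun x => rfl, fun k => ?_, fun x => ?_, fun n => ?_⟩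
  · have hlim1 : Filter.Tendsto (fun n : ℕ =>
        eLpNorm (fun x => conv K g x - convPoly s (2 ^ n) g x) 1 volume) Filter.atTop
        (nhds 0) := by
      set m : ℝ≥0∞ := volume (Set.univ : Set (Torus q)) ^ ((1 : ℝ≥0∞).toReal)⁻¹
      have hm : m ≠ ∞ := ENNReal.rpow_ne_top_of_nonneg (by simp) (measure_ne_top _ _)
      have h4 := ENNReal.Tendsto.const_mul (a := m) (ENNReal.tendsto_ofReal hlim) (Or.inr hm)
      rw [ENNReal.ofReal_zero, mul_zero] at h4
      refine tendsto_of_tendsto_of_tendsto_of_le_of_le tendsto_const_nhds h4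
        (fun _ => zero_le) fun n => ?_
      exact eLpNorm_le_of_ae_bound (.of_forall (hconv' n))
    have hc := tendsto_coeff (fun n => continuous_integrable (convPoly s (2 ^ n) g).continuous)
      (continuous_integrable hcont) hlim1 k
    refine tendsto_nhds_unique hc (tendsto_const_nhds.congr' ?_)
    filter_upwards [eventually_window_eq_one k] with n hn
    rw [coeff_convPoly hq s Nat.one_le_two_pow, hn, one_mul]
  · refine (enorm_conv_le hK hg x).trans (mul_le_mul_left ?_ _)
    exact (ENNReal.ofReal_toReal hK.2.ne).symm.le.trans
      (ENNReal.ofReal_le_ofReal (le_max_right _ _))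
  · refine ⟨convPoly s (2 ^ n) g, ?_, fun x => (hconv n x).trans (mul_le_mul_left
      (ENNReal.ofReal_le_ofReal ?_) _)⟩
    · have := convPoly_mem_trigPoly hq s (Nat.one_le_two_pow (n := n)) g
      push_cast at this
      exact this
    · gcongr
      exact le_max_left _ _

/-! ### Relations between derivatives of different orders, and symmetry of the kernel. -/

theorem bessel_mul_rpow (s r : ℝ) (k : Fin q → ℤ) :
    bessel s k * (freqNorm k ^ 2 + 1) ^ (r / 2) = (freqNorm k ^ 2 + 1) ^ ((r - s) / 2) := by
  rw [bessel, ← Real.rpow_add (by positivity)]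
  congr 1; ring

/-- Smoothing $f^{(s)}$ by the kernel of order $s-r$ produces $f^{(r)}$. The case $r=0$ recovers
$f$, and $r=s'$ gives the embedding. -/
theorem coeff_eq_of_isDeriv {s : ℝ} {p : ℝ≥0∞} {f g : Torus q → ℂ} (h : IsDeriv s p f g)
    (r : ℝ) (k : Fin q → ℤ) :
    (bessel (s - r) k : ℂ) * coeff g k =
      (((freqNorm k ^ 2 + 1) ^ (r / 2) : ℝ) : ℂ) * coeff f k := by
  rw [h.2, ← mul_assoc, ← Complex.ofReal_mul, bessel_mul_rpow, sub_sub_cancel]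

theorem ae_eq_of_isDeriv {s : ℝ} {p : ℝ≥0∞} {f g : Torus q → ℂ} (hf : Integrable f)
    (h : IsDeriv s p f g) {F : C(Torus q, ℂ)} (hF : ∀ k, coeff F k = bessel s k * coeff g k) :
    f =ᵐ[volume] F := by
  refine ae_eq_of_coeff_eq hf (continuous_integrable F.continuous) fun k => ?_
  have := coeff_eq_of_isDeriv h 0 k
  rw [sub_zero] at this
  simp [hF, this]

theorem coeff_comp_neg (f : Torus q → ℂ) (k : Fin q → ℤ) :
    coeff (fun x => f (-x)) k = coeff f (-k) := by
  rw [coeff, coeff, ← integral_neg_eq_self]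
  simp only [neg_neg, mode_neg]

theorem bessel_neg (s : ℝ) (k : Fin q → ℤ) : bessel s (-k) = bessel s k := by
  simp [bessel, freqNorm]

theorem ae_even_of_coeff_eq_bessel {s : ℝ} {K : Torus q → ℂ} (hK : Integrable K)
    (h : ∀ k, coeff K k = (bessel s k : ℂ)) : (fun x => K (-x)) =ᵐ[volume] K :=
  ae_eq_of_coeff_eq hK.comp_neg hK fun k => by rw [coeff_comp_neg, h, h, bessel_neg]

/-- Since `sobolevDeriv` is an arbitrary choice, this is what allows the Sobolev norm to be computed
from any explicit derivative. -/
theorem IsDeriv.ae_eq {s : ℝ} {p : ℝ≥0∞} (hp : 1 ≤ p) {f f' g g' : Torus q → ℂ}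
    (hf : f =ᵐ[volume] f') (h : IsDeriv s p f g) (h' : IsDeriv s p f' g') : g =ᵐ[volume] g' :=
  ae_eq_of_coeff_eq (h.1.integrable hp) (h'.1.integrable hp) fun k => by
    rw [h.2, h'.2, coeff_congr_ae hf]

end PeriodicSobolev

end

/-! ### Assembly of the four assertions. -/

theorem proposition2p1 (q : ℕ) (hq : 1 ≤ q) (p : ℝ≥0∞) (hp : 1 ≤ p) (s : ℝ)
    (hs : ((q : ℝ≥0∞) / p).toReal < s) :
    -- the kernel and the integral representation
    (∃ K : PeriodicSobolev.Torus q → ℂ,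
      MemLp K (ENNReal.conjExponent p) volume ∧
      (∀ k : Fin q → ℤ, PeriodicSobolev.coeff K k =
        (((PeriodicSobolev.freqNorm k ^ 2 + 1) ^ (-s / 2) : ℝ) : ℂ)) ∧
      ∀ f g : PeriodicSobolev.Torus q → ℂ,
        PeriodicSobolev.MemSobolev s p f → PeriodicSobolev.IsDeriv s p f g →
        ∀ᵐ x : PeriodicSobolev.Torus q,
          Integrable (fun y => K (x - y) * g y) volume ∧
          Integrable (fun y => K (y - x) * g y) volume ∧
          f x = (1 / (2 * Real.pi : ℂ) ^ q) * ∫ y, K (x - y) * g y ∧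
          f x = (1 / (2 * Real.pi : ℂ) ^ q) * ∫ y, K (y - x) * g y) ∧
    -- the continuous representative
    (∀ f : PeriodicSobolev.Torus q → ℂ, PeriodicSobolev.MemSobolev s p f →
      ∃ F : C(PeriodicSobolev.Torus q, ℂ), f =ᵐ[volume] F) ∧
    -- the degree of approximation
    (∃ c : ℝ, 0 < c ∧
      ∀ f : PeriodicSobolev.Torus q → ℂ, PeriodicSobolev.MemSobolev s p f →
      ∀ F : C(PeriodicSobolev.Torus q, ℂ), f =ᵐ[volume] F →
      ∀ n : ℕ, PeriodicSobolev.degApprox ((2 : ℝ) ^ n) ∞ F ≤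
        ENNReal.ofReal (c * (2 : ℝ) ^ (-(n : ℝ) * (s - ((q : ℝ≥0∞) / p).toReal))) *
          PeriodicSobolev.sobolevNorm s p f) ∧
    -- the embeddings
    (∀ s' : ℝ, 0 < s' → s' < s - ((q : ℝ≥0∞) / p).toReal →
      ∃ c₁ c₂ : ℝ, 0 < c₁ ∧ 0 < c₂ ∧
        ∀ f : PeriodicSobolev.Torus q → ℂ, PeriodicSobolev.MemSobolev s p f →
        ∀ F : C(PeriodicSobolev.Torus q, ℂ), f =ᵐ[volume] F →
          PeriodicSobolev.MemSobolev s' ∞ F ∧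
          eLpNorm F ∞ volume ≤
            ENNReal.ofReal c₁ * PeriodicSobolev.sobolevNorm s' ∞ F ∧
          PeriodicSobolev.sobolevNorm s' ∞ F ≤
            ENNReal.ofReal c₂ * PeriodicSobolev.sobolevNorm s p f) := by
  open PeriodicSobolev in
  have : p.HolderConjugate (ENNReal.conjExponent p) := .conjExponent hp
  obtain ⟨K, C, hC, hK, hcK, hconv⟩ :=
    exists_kernel_conv (p := p) (p' := ENNReal.conjExponent p) hq hs
  refine ⟨⟨K, hK, hcK, fun f g hf hg => ?_⟩, fun f hf => ?_, ⟨C, hC, fun f hf F hF n => ?_⟩,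
    fun s' hs' hs's => ?_⟩
  · obtain ⟨F, hF, hcF, -⟩ := hconv g hg.1
    have hKi : Integrable K :=
      hK.integrable (ENNReal.HolderConjugate.one_le (ENNReal.conjExponent p) p)
    filter_upwards [ae_eq_of_isDeriv (hf.1.integrable hp) hg hcF] with x hx
    -- The kernel is even only almost everywhere, but $y\mapsto x-y$ preserves measure, so the
    -- exceptional set stays null for each fixed $x$.
    have heven : (fun y => K (x - y) * g y) =ᵐ[volume] fun y => K (y - x) * g y := by
      have h1 := (Measure.measurePreserving_sub_left volume x).quasiMeasurePreserving.ae_eq_comp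
        (ae_even_of_coeff_eq_bessel hKi hcK)
      filter_upwards [h1] with y hy
      simp only [Function.comp_apply, neg_sub] at hy
      rw [hy]
    have hi := integrable_conv hK hg.1 x
    have hfx : f x = (1 / (2 * Real.pi : ℂ) ^ q) * ∫ y, K (x - y) * g y := hx.trans (hF x)
    exact ⟨hi, hi.congr heven, hfx, by rw [← integral_congr_ae heven]; exact hfx⟩
  · obtain ⟨F, -, hcF, -⟩ := hconv _ hf.isDeriv.1
    exact ⟨F, ae_eq_of_isDeriv (hf.1.integrable hp) hf.isDeriv hcF⟩
  · obtain ⟨F₀, -, hcF, -, happ⟩ := hconv _ hf.isDeriv.1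
    obtain ⟨T, hT, hTb⟩ := happ n
    refine (iInf₂_le T hT).trans ?_
    rw [eLpNorm_exponent_top]
    refine essSup_le_of_ae_le _ ?_
    filter_upwards [hF, ae_eq_of_isDeriv (hf.1.integrable hp) hf.isDeriv hcF] with x h1 h2
    rw [← h1, h2]
    exact hTb x
  -- Two kernels are used: order $s-s'>q/p$ carries $f^{(s)}\in L^p$ to a continuous $f^{(s')}$, and
  -- order $s'>0=q/\infty$ carries $f^{(s')}\in L^\infty$ to $f$.
  · obtain ⟨K₂, c₂, hc₂, -, -, h₂⟩ := exists_kernel_conv (p := p)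
      (p' := ENNReal.conjExponent p) hq (show ((q : ℝ≥0∞) / p).toReal < s - s' by linarith)
    obtain ⟨K₁, c₁, hc₁, -, -, h₁⟩ := exists_kernel_conv (p := ∞) (p' := 1) hq (s := s')
      (by simpa using hs')
    refine ⟨c₁, c₂, hc₁, hc₂, fun f hf F hF => ?_⟩
    obtain ⟨G, -, hcG, hGb, -⟩ := h₂ _ hf.isDeriv.1
    have hG : IsDeriv s' ∞ F G := ⟨memLp_continuousMap G ∞, fun k => by
      rw [hcG, coeff_eq_of_isDeriv hf.isDeriv, coeff_congr_ae hF]⟩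
    have hFs : MemSobolev s' ∞ F := ⟨memLp_continuousMap F ∞, G, hG⟩
    refine ⟨hFs, ?_, ?_⟩
    · obtain ⟨F₁, -, hcF₁, hF₁, -⟩ := h₁ _ hFs.isDeriv.1
      rw [eLpNorm_exponent_top]
      refine essSup_le_of_ae_le _ ?_
      filter_upwards [ae_eq_of_isDeriv (continuous_integrable F.continuous) hFs.isDeriv hcF₁]
        with x hx
      rw [hx]
      exact hF₁ x
    · rw [sobolevNorm, eLpNorm_congr_ae (hFs.isDeriv.ae_eq le_top .rfl hG), eLpNorm_exponent_top]
      exact essSup_le_of_ae_le _ (.of_forall hGb)
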